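/- Let $\nu(a)=\int_0^\infty \frac{a^{r}}{\Gamma(r+1)}\,dr$ for $a\ge 0$. For $T,\lambda,s>0$ and $a\in[0,T)$ let $\mathscr T^{T,\lambda}_s(a,\cdot)$ be the Borel measure on $[0,T]$ $$\mathscr T^{T,\lambda}_s(a,db)=\frac{\nu((T-b)\lambda)}{\nu((T-a)\lambda)}\,\frac{(b-a)^{s-1}\lambda^{s}}{\Gamma(s)}\,1_{[a,T)}(b)\,db+\Big(\frac{1}{\nu((T-a)\lambda)}\int_0^s\frac{(T-a)^r\lambda^r}{\Gamma(r+1)}\,dr\Big)\,\delta_T(db),$$ and put $\mathscr T^{T,\lambda}_s(T,\cdot)=\delta_T$ and $\mathscr T^{T,\lambda}_0(a,\cdot)=\delta_a$ for $a\in[0,T]$. Let $D([0,\infty))$ be the space of real-valued cadlag functions on $[0,\infty)$ with coordinate process $\{\eta_s\}_{s\ge 0}$, coordinate filtration $F_s=\sigma(\eta_r: r\le s)$, and the $\sigma$-algebra generated by all coordinates (the Borel $\sigma$-algebra of the Skorokhod topology). **Theorem.** Let $T>0$ and let $\vartheta$ be a Borel probability measure on $[0,T]$. For every $\lambda>0$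 there is a unique probability measure $\Pi^{T,\lambda}_\vartheta$ on $D([0,\infty))$ under which $\eta$ is Markovian with respect to $(F_s)_{s\ge0}$ with transition kernels $\{\mathscr T^{T,\lambda}_s\}_{s\ge0}$ and $\eta_0$ has distribution $\vartheta$. Let $\mathbf S=\inf\{s\in[0,\infty):\eta_s=T\}$. For all $\lambda,\lambda'>0$, $\mathbf S$ is finite $\Pi^{T,\lambda}_\vartheta$-almost surely, $\Pi^{T,\lambda'}_\vartheta$ is absolutely continuous with respect to $\Pi^{T,\lambda}_\vartheta$, and $$\frac{d\Pi^{T,\lambda'}_\vartheta}{d\Pi^{T,\lambda}_\vartheta}=\frac{\nu((T-\eta_0)\lambda)}{\nu((T-\eta_0)\lambda')}\Big(\frac{\lambda'}{\lambda}\Big)^{\mathbf S}\qquad \Pi^{T,\lambda}_\vartheta\text{-a.s.},$$ where the ratio of the values of $\nu$ is read as its limit $1$ when $\eta_0=T$. -/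

import Mathlib

open MeasureTheory ProbabilityTheory Set Filter Topology
open scoped NNReal ENNReal

noncomputable section

/-- The Volterra function `ν(a) = ∫₀^∞ a^r / Γ(r+1) dr`, for real `a ≥ 0`. -/
def volterraNu (a : ℝ) : ℝ :=
  ∫ r in Set.Ioi (0 : ℝ), a ^ r / Real.Gamma (r + 1)

/-- `D_s^{t,lam}(b) = (ν((t-b)lam) / ν(t lam)) * b^(s-1) lam^s / Γ(s)`, for `s, t, lam > 0`
and `0 < b < t`. -/
def volterraDensity (t lam s b : ℝ) : ℝ :=
  volterraNu ((t - b) * lam) / volterraNu (t * lam) *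
    (b ^ (s - 1) * lam ^ s / Real.Gamma s)

/-- `p_s^{t,lam} = ν(t lam)⁻¹ ∫₀^s t^r lam^r / Γ(r+1) dr`, for `s, t, lam > 0`. -/
def volterraAtom (t lam s : ℝ) : ℝ :=
  1 / volterraNu (t * lam) * ∫ r in (0 : ℝ)..s, t ^ r * lam ^ r / Real.Gamma (r + 1)

/-- The transition kernel from `a ∈ [0,T]` over a time `s ≥ 0`. For `s > 0` and `a < T` it is
`D_s^{T-a,lam}(b-a) 1_{[a,T)}(b) db + p_s^{T-a,lam} δ_T(db)`. At time `0` it is `δ_a`, and the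
terminal state `T` is absorbing: the kernel from `a = T` is `δ_T` for every `s`. -/
def volterraKernel (T lam s a : ℝ) : Measure ℝ :=
  if 0 < s ∧ a < T then
    (volume.restrict (Set.Ico a T)).withDensity
        (fun b => ENNReal.ofReal (volterraDensity (T - a) lam s (b - a)))
      + ENNReal.ofReal (volterraAtom (T - a) lam s) • Measure.dirac T
  else Measure.dirac a

/-- A function `ω : [0,∞) → ℝ` is cadlag: right-continuous, with left limits. -/
def IsCadlag (ω : ℝ≥0 → ℝ) : Prop :=
  (∀ t, ContinuousWithinAt ω (Set.Ici t) t) ∧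
    ∀ t, ∃ l : ℝ, Tendsto ω (𝓝[<] t) (𝓝 l)

/-- The space `D([0,∞))` of real-valued cadlag paths. -/
abbrev CadlagPath : Type := {ω : ℝ≥0 → ℝ // IsCadlag ω}

/-- The coordinate process on the cadlag path space. -/
def pathCoord (s : ℝ≥0) (ω : CadlagPath) : ℝ := ω.1 s

/-- The path space `D([0,∞))` carries the σ-algebra generated by the coordinates (this is the
Borel σ-algebra of the Skorokhod topology). It is the σ-algebra that Mathlib puts on a subtype of
a product. -/
theorem cadlagPath_measurableSpace_eq :
    (inferInstance : MeasurableSpace CadlagPath) =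
      ⨆ s : ℝ≥0, MeasurableSpace.comap (pathCoord s) (borel ℝ) := by
  have h : (inferInstance : MeasurableSpace CadlagPath) =
      MeasurableSpace.comap Subtype.val MeasurableSpace.pi := rfl
  rw [h, MeasurableSpace.pi, MeasurableSpace.comap_iSup]
  simp only [MeasurableSpace.comap_comp, ← BorelSpace.measurable_eq (α := ℝ)]
  rfl

theorem measurable_pathCoord (s : ℝ≥0) : Measurable (pathCoord s) :=
  (measurable_pi_apply s).comp measurable_subtype_coe

/-- The filtration `F_s` generated by the coordinate process. -/
def coordFiltration :
    Filtration ℝ≥0 (inferInstance : MeasurableSpace CadlagPath) :=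
  Filtration.natural pathCoord fun s => (measurable_pathCoord s).stronglyMeasurable

/-- `P` is a probability measure on the path space under which the coordinate process is Markovian
with respect to its own filtration, with transition kernels `volterraKernel T lam`, and has initial
distribution `ϑ`. -/
structure IsVolterraPathLaw (T lam : ℝ) (ϑ : Measure (Set.Icc (0 : ℝ) T))
    (P : Measure CadlagPath) : Prop where
  isProbabilityMeasure : IsProbabilityMeasure P
  initial : P.map (pathCoord 0) = ϑ.map Subtype.val
  markov : ∀ (s t : ℝ≥0) (B : Set ℝ), MeasurableSet B →
    P⟦pathCoord (s + t) ⁻¹' B | coordFiltration s⟧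
      =ᵐ[P] fun ω => (volterraKernel T lam t (pathCoord s ω)).real B

/-- The absorption time `S = inf {s ≥ 0 : η_s = T}`, with `inf ∅ = ∞`. -/
def absorptionTime (T : ℝ) (ω : CadlagPath) : ℝ≥0∞ :=
  ⨅ (s : ℝ≥0) (_ : pathCoord s ω = T), (s : ℝ≥0∞)

/-- The ratio `ν((T-a) lam') / ν((T-a) lam)` for `a < T`, extended to `a = T` by its
limit `1` as `a ↗ T`. -/
def volterraRatio (T lam lam' a : ℝ) : ℝ :=
  if a < T then volterraNu ((T - a) * lam') / volterraNu ((T - a) * lam) else 1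

end

open scoped BoundedContinuousFunction

noncomputable section

/-! ### The Volterra function -/

/-! Write g_s(x) = x^(s-1) lam^s / Γ(s), w_r(x) = x^r lam^r / Γ(r+1) and h(x) = ν(x lam), where x is
the distance to T in w_r and h. The Beta integral makes the g_s a convolution semigroup
(`lintegral_gammaWeight_mul`). Since w_r = g_(r+1) / lam, it also gives g_s * w_r = w_(s+r). As h =
∫_0^∞ w_r dr, convolving h with g_s leaves the tail ∫_s^∞ w_r dr ≤ h
(`lintegral_volterraMass_mul_gammaWeight`). So h is excessive, and the Volterra kernel is the Doob
transform h(T-b) g_s(b-a) / h(T-a), with the missing mass moved to the absorbing point T. Total mass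
one and Chapman–Kolmogorov follow by Fubini, and w_r(T-a) / h(T-a) is the density of the absorption
time from a.

Existence of a cadlag version uses that the kernels only move upwards. Chains on the dyadic grids
are realised on one probability space, almost every sample is nondecreasing and bounded by T, and
limits from the right over the grids define a cadlag path. The Markov property survives the limit
because the kernels are continuous in time and in starting points approached from above
(`tendsto_integral_volterraKer`). The delicate case is time 0, where g_s is singular; the
substitution b = a + (T-a) y^(1/t) removes the singularity. Uniqueness holds because initial law and
kernels fix all finite-dimensional laws (`IsMarkovLaw.map_eq`).

For the density, passing from lam to lam' multiplies g_s by (lam'/lam)^s and w_r by (lam'/lam)^r;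
everything else is the normalisation h. Along a path the time factors accumulate until absorption,
so they give (lam'/lam)^S, while the factors h telescope to a function of the starting point.
Formally, `volterraKernel_change_parameter` splits according to absorption before or after time t,
and `IsVolterraPathLaw.withDensity` deduces that the reweighted measure is a path law for lam'.
Uniqueness then identifies it with the given one. -/

theorem measurable_inv_Gamma : Measurable fun r : ℝ => (Real.Gamma r)⁻¹ := by
  -- The reciprocal of Γ is entire, so the poles of Γ need no separate treatment.
  have h : Continuous fun r : ℝ => ((Complex.Gamma (r : ℂ))⁻¹).re :=
    Complex.continuous_re.comp
      (Complex.differentiable_one_div_Gamma.continuous.comp Complex.continuous_ofReal)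
  refine (h.congr fun r => ?_).measurable
  rw [Complex.Gamma_ofReal, ← Complex.ofReal_inv, Complex.ofReal_re]

@[fun_prop]
theorem measurable_realGamma : Measurable Real.Gamma := by
  have h := measurable_inv_Gamma.fun_inv
  simpa only [inv_inv] using h

/-- Keep only the part of the Gamma integral over (c, ∞), where x^r ≥ c^r. -/
theorem rpow_mul_exp_neg_le_Gamma {c r : ℝ} (hc : 0 < c) (hr : 0 ≤ r) :
    c ^ r * Real.exp (-c) ≤ Real.Gamma (r + 1) := by
  have hint := Real.GammaIntegral_convergent (s := r + 1) (by linarith)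
  rw [Real.Gamma_eq_integral (by linarith), ← integral_exp_neg_Ioi, ← integral_const_mul]
  refine (setIntegral_mono_on ?_ (hint.mono_set (Ioi_subset_Ioi hc.le)) measurableSet_Ioi ?_).trans
    (setIntegral_mono_set hint ?_ (Ioi_subset_Ioi hc.le).eventuallyLE)
  · have := integrableOn_exp_mul_Ioi (a := -1) (by norm_num) c
    simp only [neg_mul, one_mul] at this
    exact this.const_mul _
  · intro x hx
    rw [mul_comm, add_sub_cancel_right]
    gcongr
    exact (mem_Ioi.1 hx).le
  · refine (ae_restrict_mem measurableSet_Ioi).mono fun x hx => ?_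
    have : 0 < x := hx
    simp only [Pi.zero_apply]
    positivity

/-- The lower bound on Γ at c = 2A + 1 gives a geometric decay in r, since a ≤ c/2; the summand 1
keeps c positive at A = 0. The bound is uniform in a ≤ A, so it serves as dominating function both
for integrability and for continuity of ν. -/
theorem rpow_div_Gamma_le {a A r : ℝ} (ha : 0 ≤ a) (hA : a ≤ A) (hr : 0 ≤ r) :
    a ^ r / Real.Gamma (r + 1) ≤
      Real.exp (2 * A + 1) * Real.exp (-Real.log 2 * r) := by
  have hc : 0 < 2 * A + 1 := by linarith
  have hG : 0 < Real.Gamma (r + 1) := Real.Gamma_pos_of_pos (by linarith)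
  rw [div_le_iff₀ hG]
  have h1 := rpow_mul_exp_neg_le_Gamma hc hr
  have h2 : Real.exp (-Real.log 2 * r) = (1 / 2 : ℝ) ^ r := by
    rw [Real.rpow_def_of_pos (by norm_num), one_div, Real.log_inv]
  calc a ^ r ≤ ((1 / 2) * (2 * A + 1)) ^ r := by
        apply Real.rpow_le_rpow ha _ hr; linarith
    _ = Real.exp (2 * A + 1) * (1 / 2 : ℝ) ^ r * ((2 * A + 1) ^ r * Real.exp (-(2 * A + 1))) := by
        rw [Real.mul_rpow (by norm_num) hc.le, Real.exp_neg]
        field_simp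
    _ ≤ _ := by rw [h2]; gcongr

theorem integrableOn_volterra_bound (A : ℝ) :
    IntegrableOn (fun r => Real.exp (2 * A + 1) * Real.exp (-Real.log 2 * r)) (Ioi 0) :=
  (integrableOn_exp_mul_Ioi (by simp [Real.log_pos]) 0).const_mul _

theorem measurable_rpow_div_Gamma :
    Measurable fun p : ℝ × ℝ => p.1 ^ p.2 / Real.Gamma (p.2 + 1) :=
  (measurable_fst.pow measurable_snd).div (by fun_prop)

theorem rpow_div_Gamma_nonneg {a r : ℝ} (ha : 0 ≤ a) (hr : 0 ≤ r) :
    0 ≤ a ^ r / Real.Gamma (r + 1) :=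
  div_nonneg (Real.rpow_nonneg ha _) (Real.Gamma_pos_of_pos (by linarith)).le

theorem integrableOn_rpow_div_Gamma {a : ℝ} (ha : 0 ≤ a) :
    IntegrableOn (fun r : ℝ => a ^ r / Real.Gamma (r + 1)) (Ioi 0) := by
  refine (integrableOn_volterra_bound a).mono'
    (measurable_rpow_div_Gamma.comp measurable_prodMk_left).aestronglyMeasurable ?_
  refine (ae_restrict_mem measurableSet_Ioi).mono fun r hr => ?_
  rw [Real.norm_of_nonneg (rpow_div_Gamma_nonneg ha (le_of_lt hr))]
  exact rpow_div_Gamma_le ha le_rfl (le_of_lt hr)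

theorem measurable_volterraNu : Measurable volterraNu :=
  (measurable_rpow_div_Gamma.stronglyMeasurable.integral_prod_right'
    (ν := volume.restrict (Ioi (0 : ℝ)))).measurable

theorem volterraNu_nonneg {a : ℝ} (ha : 0 ≤ a) : 0 ≤ volterraNu a :=
  setIntegral_nonneg measurableSet_Ioi fun _ hr => rpow_div_Gamma_nonneg ha (le_of_lt hr)

theorem volterraNu_pos {a : ℝ} (ha : 0 < a) : 0 < volterraNu a := by
  rw [volterraNu, setIntegral_pos_iff_support_of_nonneg_ae
    ((ae_restrict_mem measurableSet_Ioi).mono fun r hr =>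
      rpow_div_Gamma_nonneg ha.le (le_of_lt hr)) (integrableOn_rpow_div_Gamma ha.le)]
  refine lt_of_lt_of_le (b := volume (Ioi (0 : ℝ))) (by simp) (measure_mono fun r hr => ?_)
  refine ⟨?_, hr⟩
  have : 0 < Real.Gamma (r + 1) := Real.Gamma_pos_of_pos (by have : (0 : ℝ) < r := hr; linarith)
  exact (div_pos (Real.rpow_pos_of_pos ha _) this).ne'

theorem volterraNu_mono {a b : ℝ} (ha : 0 ≤ a) (hab : a ≤ b) : volterraNu a ≤ volterraNu b := by
  refine setIntegral_mono_on (integrableOn_rpow_div_Gamma ha)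
    (integrableOn_rpow_div_Gamma (ha.trans hab)) measurableSet_Ioi fun r hr => ?_
  have hr' : (0 : ℝ) < r := hr
  have : 0 < Real.Gamma (r + 1) := Real.Gamma_pos_of_pos (by linarith)
  gcongr

theorem continuousOn_volterraNu : ContinuousOn volterraNu (Ici 0) := by
  intro a ha
  have hA : ∀ᶠ x in 𝓝[Ici 0] a, x ≤ a + 1 :=
    mem_nhdsWithin_of_mem_nhds (Iic_mem_nhds (by linarith))
  refine tendsto_integral_filter_of_dominated_convergence _
    (.of_forall fun x =>
      (measurable_rpow_div_Gamma.comp measurable_prodMk_left).aestronglyMeasurable)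
    ?_ (integrableOn_volterra_bound (a + 1)) ?_
  · filter_upwards [hA, self_mem_nhdsWithin] with x hx hx0
    refine (ae_restrict_mem measurableSet_Ioi).mono fun r hr => ?_
    rw [Real.norm_of_nonneg (rpow_div_Gamma_nonneg hx0 (le_of_lt hr))]
    exact rpow_div_Gamma_le hx0 hx (le_of_lt hr)
  · refine (ae_restrict_mem measurableSet_Ioi).mono fun r hr => ?_
    exact ((Real.continuousAt_rpow_const a r (Or.inr (le_of_lt hr))).tendsto.div_const _).mono_left
      nhdsWithin_le_nhds

/-! ### Weights of the gamma semigroup and of the absorption time -/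

/-- `x^(s-1) lam^s / Γ(s)`, the Lebesgue density of the unnormalised gamma semigroup. -/
def gammaWeight (lam s x : ℝ) : ℝ≥0∞ := ENNReal.ofReal (x ^ (s - 1) * lam ^ s / Real.Gamma s)

/-- `x^r lam^r / Γ(r+1)`, the unnormalised density at `r` of the absorption time of the Volterra
process started at distance `x` from the terminal state. -/
def absorptionWeight (lam x r : ℝ) : ℝ≥0∞ :=
  ENNReal.ofReal (x ^ r * lam ^ r / Real.Gamma (r + 1))

/-- `volterraNu` with values in `ℝ≥0∞`. -/
def volterraMass (lam x : ℝ) : ℝ≥0∞ := ENNReal.ofReal (volterraNu (x * lam))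

@[fun_prop]
theorem measurable_gammaWeight (lam s : ℝ) : Measurable (gammaWeight lam s) := by
  unfold gammaWeight; fun_prop

@[fun_prop]
theorem Measurable.absorptionWeight {α : Type*} [MeasurableSpace α] {f g : α → ℝ} (lam : ℝ)
    (hf : Measurable f) (hg : Measurable g) :
    Measurable fun x => absorptionWeight lam (f x) (g x) := by
  unfold _root_.absorptionWeight
  exact ((hf.pow hg).mul (measurable_const.pow hg)).div (by fun_prop) |>.ennreal_ofReal

@[fun_prop]
theorem measurable_volterraMass (lam : ℝ) : Measurable (volterraMass lam) :=
  (measurable_volterraNu.comp (measurable_id.mul_const lam)).ennreal_ofReal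

theorem volterraMass_ne_zero {lam : ℝ} (hlam : 0 < lam) {x : ℝ} (hx : 0 < x) :
    volterraMass lam x ≠ 0 := by
  simpa [volterraMass] using volterraNu_pos (mul_pos hx hlam)

theorem volterraMass_ne_top (lam x : ℝ) : volterraMass lam x ≠ ∞ := ENNReal.ofReal_ne_top

theorem lintegral_absorptionWeight {lam : ℝ} (hlam : 0 < lam) {x : ℝ} (hx : 0 < x) :
    ∫⁻ r in Ioi 0, absorptionWeight lam x r = volterraMass lam x := by
  have h0 : 0 ≤ x * lam := by positivity
  rw [volterraMass, volterraNu, ofReal_integral_eq_lintegral_ofReal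
    (integrableOn_rpow_div_Gamma h0)
    ((ae_restrict_mem measurableSet_Ioi).mono fun r hr =>
      rpow_div_Gamma_nonneg h0 (le_of_lt hr))]
  refine setLIntegral_congr_fun measurableSet_Ioi fun r hr => ?_
  simp only [absorptionWeight]
  rw [Real.mul_rpow hx.le hlam.le]

/-- Lets the convolution semigroup act on absorption weights: they are gamma weights with the time
shifted by one. -/
theorem absorptionWeight_eq {lam : ℝ} (hlam : 0 < lam) (x : ℝ) {r : ℝ} :
    absorptionWeight lam x r = (ENNReal.ofReal lam)⁻¹ * gammaWeight lam (r + 1) x := by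
  rw [absorptionWeight, gammaWeight, ← ENNReal.ofReal_inv_of_pos hlam,
    ← ENNReal.ofReal_mul (by positivity), add_sub_cancel_right, Real.rpow_add hlam, Real.rpow_one]
  congr 1
  field_simp

/-- The semigroup property of the gamma weights, a form of the Beta integral. -/
theorem lintegral_gammaWeight_mul {lam : ℝ} (hlam : 0 < lam) {s t x : ℝ}
    (hs : 0 < s) (ht : 0 < t) (hx : 0 < x) :
    ∫⁻ y in Ioo 0 x, gammaWeight lam s y * gammaWeight lam t (x - y) =
      gammaWeight lam (s + t) x := by
  have hGs := Real.Gamma_pos_of_pos hs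
  have hGt := Real.Gamma_pos_of_pos ht
  have hGst := Real.Gamma_pos_of_pos (add_pos hs ht)
  -- Rescaling y = x u turns the convolution into a multiple of the Beta density, whose total mass
  -- is one.
  have himg : (fun u : ℝ => x * u) '' Ioo 0 1 = Ioo 0 x := by
    rw [image_mul_left_Ioo hx]; simp
  rw [← himg, lintegral_image_eq_lintegral_abs_deriv_mul (f' := fun _ => x) measurableSet_Ioo
    (fun u _ => by simpa using ((hasDerivAt_id u).const_mul x).hasDerivWithinAt)
    (mul_right_injective₀ hx.ne').injOn]
  have hB := lintegral_betaPDF_eq_one hs ht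
  rw [lintegral_betaPDF] at hB
  rw [← mul_one (gammaWeight lam (s + t) x), ← hB, ← lintegral_const_mul]
  · refine setLIntegral_congr_fun measurableSet_Ioo fun u hu => ?_
    have hu0 : 0 < u := hu.1
    have hu1 : 0 < 1 - u := by linarith [hu.2]
    have hxu : x - x * u = x * (1 - u) := by ring
    simp only [gammaWeight]
    rw [hxu, ← ENNReal.ofReal_mul (by positivity), ← ENNReal.ofReal_mul (by positivity),
      ← ENNReal.ofReal_mul (by positivity)]
    congr 1
    rw [abs_of_pos hx, beta, Real.mul_rpow hx.le hu0.le, Real.mul_rpow hx.le hu1.le,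
      Real.rpow_add hlam, show s + t - 1 = (s - 1) + (t - 1) + 1 by ring,
      Real.rpow_add hx, Real.rpow_add hx, Real.rpow_one]
    field_simp
  · fun_prop

/-- The semigroup property with second time r + 1. In probabilistic terms, time s alive followed by
a remaining lifetime r makes a lifetime s + r. -/
theorem lintegral_gammaWeight_mul_absorptionWeight {lam : ℝ} (hlam : 0 < lam) {s r x : ℝ}
    (hs : 0 < s) (hr : 0 < r + 1)
    (hx : 0 < x) :
    ∫⁻ y in Ioo 0 x, gammaWeight lam s y * absorptionWeight lam (x - y) r =
      absorptionWeight lam x (s + r) := by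
  have h : ∀ y, gammaWeight lam s y * absorptionWeight lam (x - y) r =
      (ENNReal.ofReal lam)⁻¹ * (gammaWeight lam s y * gammaWeight lam (r + 1) (x - y)) := by
    intro y
    rw [absorptionWeight_eq hlam]
    ring
  simp_rw [h]
  rw [lintegral_const_mul _ (by fun_prop), lintegral_gammaWeight_mul hlam hs hr hx,
    absorptionWeight_eq hlam, add_assoc]

/-! ### The Volterra kernels -/

theorem setLIntegral_preimage_add_left (c : ℝ) (S : Set ℝ) (f : ℝ → ℝ≥0∞) :
    ∫⁻ y in (fun y => c + y) ⁻¹' S, f (c + y) = ∫⁻ y in S, f y :=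
  (measurePreserving_add_left volume c).setLIntegral_comp_preimage_emb
    (MeasurableEquiv.addLeft c).measurableEmbedding f S

theorem setLIntegral_Ioo_eq_add_left (a b : ℝ) (f : ℝ → ℝ≥0∞) :
    ∫⁻ y in Ioo a b, f y = ∫⁻ y in Ioo 0 (b - a), f (a + y) := by
  rw [← setLIntegral_preimage_add_left a]
  simp

theorem volterraKernel_of_pos_of_lt {T lam s a : ℝ} (hs : 0 < s) (ha : a < T) :
    volterraKernel T lam s a = (volume.restrict (Set.Ico a T)).withDensity
        (fun b => ENNReal.ofReal (volterraDensity (T - a) lam s (b - a)))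
      + ENNReal.ofReal (volterraAtom (T - a) lam s) • Measure.dirac T :=
  if_pos ⟨hs, ha⟩

theorem volterraKernel_zero (T lam a : ℝ) : volterraKernel T lam 0 a = Measure.dirac a :=
  if_neg fun h => lt_irrefl _ h.1

theorem volterraKernel_of_le {T a : ℝ} (lam s : ℝ) (ha : T ≤ a) :
    volterraKernel T lam s a = Measure.dirac a :=
  if_neg fun h => ha.not_gt h.2

theorem measurable_volterraDensity (t lam s : ℝ) : Measurable (volterraDensity t lam s) := by
  unfold volterraDensity
  have := measurable_volterraNu
  fun_prop

/-- Displays the density as a Doob transform. The bound on b keeps the argument of ν nonnegative, so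
that `ENNReal.ofReal` is multiplicative here. -/
theorem ofReal_volterraDensity {lam : ℝ} (hlam : 0 < lam) {t b : ℝ} (s : ℝ) (ht : 0 < t)
    (hb : b ≤ t) :
    ENNReal.ofReal (volterraDensity t lam s b) =
      (volterraMass lam t)⁻¹ * (volterraMass lam (t - b) * gammaWeight lam s b) := by
  have h1 := volterraNu_pos (mul_pos ht hlam)
  have h2 : 0 ≤ volterraNu ((t - b) * lam) :=
    volterraNu_nonneg (mul_nonneg (by linarith) hlam.le)
  rw [volterraDensity, volterraMass, volterraMass, gammaWeight, ← ENNReal.ofReal_inv_of_pos h1,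
    ← ENNReal.ofReal_mul h2, ← ENNReal.ofReal_mul (by positivity)]
  congr 1
  field_simp

theorem ofReal_volterraAtom {lam : ℝ} (hlam : 0 < lam) {t s : ℝ} (ht : 0 < t) (hs : 0 ≤ s) :
    ENNReal.ofReal (volterraAtom t lam s) =
      (volterraMass lam t)⁻¹ * ∫⁻ r in Ioc 0 s, absorptionWeight lam t r := by
  have h1 := volterraNu_pos (mul_pos ht hlam)
  have h0 : 0 ≤ t * lam := by positivity
  have hnn : ∀ r ∈ Ioi (0 : ℝ), 0 ≤ t ^ r * lam ^ r / Real.Gamma (r + 1) := fun r hr => by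
    rw [← Real.mul_rpow ht.le hlam.le]
    exact rpow_div_Gamma_nonneg h0 (le_of_lt hr)
  have hint : IntegrableOn (fun r : ℝ => t ^ r * lam ^ r / Real.Gamma (r + 1)) (Ioi 0) :=
    (integrableOn_rpow_div_Gamma h0).congr_fun
      (fun r _ => by simp only [Real.mul_rpow ht.le hlam.le]) measurableSet_Ioi
  rw [volterraAtom, intervalIntegral.integral_of_le hs, one_div,
    ENNReal.ofReal_mul (inv_nonneg.2 h1.le), ENNReal.ofReal_inv_of_pos h1,
    ofReal_integral_eq_lintegral_ofReal (hint.mono_set Ioc_subset_Ioi_self)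
      ((ae_restrict_mem measurableSet_Ioc).mono fun r hr => hnn r hr.1)]
  rfl

/-- Integration against the Volterra kernel, with all factors in `ℝ≥0∞`. -/
theorem lintegral_volterraKernel {T lam s a : ℝ} (hlam : 0 < lam) (hs : 0 < s) (ha : a < T)
    {f : ℝ → ℝ≥0∞} (hf : Measurable f) :
    ∫⁻ b, f b ∂volterraKernel T lam s a =
      (volterraMass lam (T - a))⁻¹ *
        ((∫⁻ b in Ioo a T, volterraMass lam (T - b) * gammaWeight lam s (b - a) * f b) +
          (∫⁻ r in Ioc 0 s, absorptionWeight lam (T - a) r) * f T) := by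
  have hm : Measurable fun b => ENNReal.ofReal (volterraDensity (T - a) lam s (b - a)) :=
    ((measurable_volterraDensity _ _ _).comp (measurable_id.sub_const a)).ennreal_ofReal
  rw [volterraKernel_of_pos_of_lt hs ha, lintegral_add_measure, lintegral_smul_measure,
    lintegral_dirac' _ hf, lintegral_withDensity_eq_lintegral_mul _ hm hf,
    ofReal_volterraAtom hlam (sub_pos.2 ha) hs.le, mul_add, smul_eq_mul, ← mul_assoc,
    restrict_Ioo_eq_restrict_Ico]
  congr 1
  rw [← lintegral_const_mul _ (by fun_prop)]
  refine setLIntegral_congr_fun measurableSet_Ico fun b hb => ?_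
  simp only [Pi.mul_apply]
  rw [ofReal_volterraDensity hlam _ (sub_pos.2 ha) (by linarith [hb.2]),
    show T - a - (b - a) = T - b by ring, mul_assoc, mul_assoc]

theorem volterraKernel_apply {T lam s a : ℝ} (hlam : 0 < lam) (hs : 0 < s) (ha : a < T)
    {B : Set ℝ} (hB : MeasurableSet B) :
    volterraKernel T lam s a B =
      (volterraMass lam (T - a))⁻¹ *
        ((∫⁻ b in Ioo a T, volterraMass lam (T - b) * gammaWeight lam s (b - a) *
            B.indicator 1 b) +
          (∫⁻ r in Ioc 0 s, absorptionWeight lam (T - a) r) * B.indicator 1 T) := by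
  rw [← lintegral_indicator_one hB, lintegral_volterraKernel hlam hs ha
    (measurable_one.indicator hB)]

/-- The domain of integration moves with a; an indicator on the product makes it fixed, and the
measurability part of Tonelli's theorem applies. -/
theorem measurable_lintegral_Ioo_left (T : ℝ) {g : ℝ → ℝ → ℝ≥0∞}
    (hg : Measurable (Function.uncurry g)) : Measurable fun a => ∫⁻ b in Ioo a T, g a b := by
  have h : ∀ a, ∫⁻ b in Ioo a T, g a b =
      ∫⁻ b, {p : ℝ × ℝ | p.1 < p.2 ∧ p.2 < T}.indicator (Function.uncurry g) (a, b) := by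
    intro a
    rw [← lintegral_indicator measurableSet_Ioo]
    rfl
  simp_rw [h]
  refine Measurable.lintegral_prod_right' (hg.indicator ?_)
  exact (measurableSet_lt measurable_fst measurable_snd).inter
    (measurableSet_lt measurable_snd measurable_const)

theorem measurable_volterraKernel (T : ℝ) {lam : ℝ} (hlam : 0 < lam) (s : ℝ) :
    Measurable (volterraKernel T lam s) := by
  by_cases hs : 0 < s
  swap
  · have h : volterraKernel T lam s = Measure.dirac :=
      funext fun a => if_neg fun h => hs h.1
    rw [h]
    exact Measure.measurable_dirac
  refine Measure.measurable_of_measurable_coe _ fun B hB => ?_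
  have h : (fun a => volterraKernel T lam s a B) = fun a => if a < T then
      (volterraMass lam (T - a))⁻¹ *
        ((∫⁻ b in Ioo a T, volterraMass lam (T - b) * gammaWeight lam s (b - a) *
            B.indicator 1 b) +
          (∫⁻ r in Ioc 0 s, absorptionWeight lam (T - a) r) * B.indicator 1 T)
      else Measure.dirac a B := by
    funext a
    split_ifs with ha
    · exact volterraKernel_apply hlam hs ha hB
    · rw [volterraKernel_of_le _ _ (not_lt.1 ha)]
  rw [h]
  have h1 : Measurable (B.indicator (1 : ℝ → ℝ≥0∞)) := measurable_one.indicator hB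
  refine Measurable.ite measurableSet_Iio ?_
    ((Measure.measurable_coe hB).comp Measure.measurable_dirac)
  refine Measurable.mul (by fun_prop) (Measurable.add ?_ (Measurable.mul_const ?_ _))
  · refine measurable_lintegral_Ioo_left T ?_
    simp only [Function.uncurry_def]
    fun_prop
  · exact Measurable.lintegral_prod_right' (f := fun p : ℝ × ℝ => absorptionWeight lam (T - p.1) p.2)
      (by fun_prop)

/-- The Volterra kernels, as kernels in the sense of Mathlib. -/
def volterraKer (T : ℝ) {lam : ℝ} (hlam : 0 < lam) (t : ℝ≥0) : Kernel ℝ ℝ where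
  toFun := volterraKernel T lam t
  measurable' := measurable_volterraKernel T hlam t

theorem volterraKer_apply (T : ℝ) {lam : ℝ} (hlam : 0 < lam) (t : ℝ≥0) (a : ℝ) :
    volterraKer T hlam t a = volterraKernel T lam t a := rfl

theorem volterraKer_zero (T : ℝ) {lam : ℝ} (hlam : 0 < lam) (a : ℝ) :
    volterraKer T hlam 0 a = Measure.dirac a := volterraKernel_zero T lam a

/-! ### Total mass one and the Chapman–Kolmogorov equations -/

/-- Expand ν as an integral over lifetimes r, exchange the integrals and convolve: lifetimes are
shifted by s. Thus the mass not yet absorbed at time s is the tail of the lifetime weight. -/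
theorem lintegral_volterraMass_mul_gammaWeight {T lam a s : ℝ} (hlam : 0 < lam) (hs : 0 < s)
    (ha : a < T) :
    ∫⁻ b in Ioo a T, volterraMass lam (T - b) * gammaWeight lam s (b - a) =
      ∫⁻ r in Ioi s, absorptionWeight lam (T - a) r := by
  calc _ = ∫⁻ b in Ioo a T, ∫⁻ r in Ioi 0, gammaWeight lam s (b - a) *
        absorptionWeight lam (T - b) r := by
        refine setLIntegral_congr_fun measurableSet_Ioo fun b hb => ?_
        rw [lintegral_const_mul _ (by fun_prop),
          lintegral_absorptionWeight hlam (sub_pos.2 hb.2), mul_comm]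
    _ = ∫⁻ r in Ioi 0, ∫⁻ b in Ioo a T, gammaWeight lam s (b - a) *
        absorptionWeight lam (T - b) r := by
        refine lintegral_lintegral_swap (Measurable.aemeasurable ?_)
        simp only [Function.uncurry_def]
        fun_prop
    _ = ∫⁻ r in Ioi 0, absorptionWeight lam (T - a) (s + r) := by
        refine setLIntegral_congr_fun measurableSet_Ioi fun r hr => ?_
        have hr' : (0 : ℝ) < r := hr
        rw [setLIntegral_Ioo_eq_add_left, ← lintegral_gammaWeight_mul_absorptionWeight hlam hs
          (by linarith) (sub_pos.2 ha)]
        simp only [add_sub_cancel_left, ← sub_sub]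
    _ = _ := by
        rw [← setLIntegral_preimage_add_left s (Ioi s)]
        simp

/-- The absolutely continuous part carries the lifetimes beyond s and the atom those up to s;
together they exhaust the normalising integral. -/
theorem volterraKernel_univ {T lam : ℝ} (hlam : 0 < lam) (s a : ℝ) :
    volterraKernel T lam s a univ = 1 := by
  by_cases h : 0 < s ∧ a < T
  swap
  · simp [volterraKernel, h]
  rw [volterraKernel_apply hlam h.1 h.2 MeasurableSet.univ]
  simp only [indicator_univ, Pi.one_apply, mul_one]
  rw [lintegral_volterraMass_mul_gammaWeight hlam h.1 h.2, add_comm,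
    ← lintegral_union measurableSet_Ioi Ioc_disjoint_Ioi_same, Ioc_union_Ioi_eq_Ioi h.1.le,
    lintegral_absorptionWeight hlam (sub_pos.2 h.2),
    ENNReal.inv_mul_cancel (volterraMass_ne_zero hlam (sub_pos.2 h.2)) (volterraMass_ne_top _ _)]

instance (T : ℝ) {lam : ℝ} (hlam : 0 < lam) (t : ℝ≥0) : IsMarkovKernel (volterraKer T hlam t) :=
  ⟨fun a => ⟨volterraKernel_univ hlam t a⟩⟩

/-- Fubini on the region a < b < c < T, followed by the convolution identity in the intermediate
point b. -/
theorem lintegral_Ioo_Ioo_gammaWeight {T lam a s t : ℝ} (hlam : 0 < lam) (hs : 0 < s)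
    (ht : 0 < t) {g : ℝ → ℝ≥0∞} (hg : Measurable g) :
    ∫⁻ b in Ioo a T, ∫⁻ c in Ioo b T,
        gammaWeight lam s (b - a) * gammaWeight lam t (c - b) * g c =
      ∫⁻ c in Ioo a T, gammaWeight lam (s + t) (c - a) * g c := by
  let F : ℝ → ℝ → ℝ≥0∞ := fun b c => {p : ℝ × ℝ | a < p.1 ∧ p.1 < p.2 ∧ p.2 < T}.indicator
    (fun p => gammaWeight lam s (p.1 - a) * gammaWeight lam t (p.2 - p.1) * g p.2) (b, c)
  have hFmem : ∀ {b c}, a < b → b < c → c < T →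
      F b c = gammaWeight lam s (b - a) * gammaWeight lam t (c - b) * g c := fun hb hbc hc =>
    indicator_of_mem (s := {p : ℝ × ℝ | a < p.1 ∧ p.1 < p.2 ∧ p.2 < T}) ⟨hb, hbc, hc⟩ _
  have hFnot : ∀ {b c}, ¬ (a < b ∧ b < c ∧ c < T) → F b c = 0 := fun h =>
    indicator_of_notMem (s := {p : ℝ × ℝ | a < p.1 ∧ p.1 < p.2 ∧ p.2 < T}) h _
  have hF : Measurable (Function.uncurry F) := by
    refine Measurable.indicator (by fun_prop) ?_
    exact (measurableSet_lt measurable_const measurable_fst).inter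
      ((measurableSet_lt measurable_fst measurable_snd).inter
        (measurableSet_lt measurable_snd measurable_const))
  have h1 : ∫⁻ b in Ioo a T, ∫⁻ c in Ioo b T,
        gammaWeight lam s (b - a) * gammaWeight lam t (c - b) * g c = ∫⁻ b, ∫⁻ c, F b c := by
    rw [← lintegral_indicator measurableSet_Ioo]
    refine lintegral_congr fun b => ?_
    by_cases hb : b ∈ Ioo a T
    · rw [indicator_of_mem hb, ← lintegral_indicator measurableSet_Ioo]
      refine lintegral_congr fun c => ?_
      by_cases hc : c ∈ Ioo b T
      · rw [indicator_of_mem hc, hFmem hb.1 hc.1 hc.2]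
      · rw [indicator_of_notMem hc, hFnot fun h => hc h.2]
    · rw [indicator_of_notMem hb]
      have : ∀ c, F b c = 0 := fun c => hFnot fun h => hb ⟨h.1, h.2.1.trans h.2.2⟩
      simp [this]
  have h2 : ∫⁻ c, ∫⁻ b, F b c = ∫⁻ c in Ioo a T, gammaWeight lam (s + t) (c - a) * g c := by
    rw [← lintegral_indicator measurableSet_Ioo]
    refine lintegral_congr fun c => ?_
    by_cases hc : c ∈ Ioo a T
    · rw [indicator_of_mem hc]
      have : ∫⁻ b, F b c = ∫⁻ b in Ioo a c,
          gammaWeight lam s (b - a) * gammaWeight lam t (c - b) * g c := by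
        rw [← lintegral_indicator measurableSet_Ioo]
        refine lintegral_congr fun b => ?_
        by_cases hb : b ∈ Ioo a c
        · rw [indicator_of_mem hb, hFmem hb.1 hb.2 hc.2]
        · rw [indicator_of_notMem hb, hFnot fun h => hb ⟨h.1, h.2.1⟩]
      rw [this, lintegral_mul_const _ (by fun_prop), setLIntegral_Ioo_eq_add_left,
        ← lintegral_gammaWeight_mul hlam hs ht (sub_pos.2 hc.1)]
      simp only [add_sub_cancel_left, ← sub_sub]
    · rw [indicator_of_notMem hc]
      have : ∀ b, F b c = 0 := fun b => hFnot fun h => hc ⟨h.1.trans h.2.1, h.2.2⟩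
      simp [this]
  rw [h1, lintegral_lintegral_swap hF.aemeasurable, h2]

/-- The Chapman–Kolmogorov equations for the Volterra kernels. -/
theorem volterraKer_add (T : ℝ) {lam : ℝ} (hlam : 0 < lam) (s t : ℝ≥0) :
    volterraKer T hlam (s + t) = volterraKer T hlam t ∘ₖ volterraKer T hlam s := by
  ext a B hB
  rw [Kernel.comp_apply' _ _ _ hB]
  have hmt : Measurable fun b => volterraKer T hlam t b B := Kernel.measurable_coe _ hB
  rcases eq_or_lt_of_le (zero_le (a := s)) with rfl | hs
  · rw [volterraKer_zero, lintegral_dirac' _ hmt, zero_add]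
  rcases eq_or_lt_of_le (zero_le (a := t)) with rfl | ht
  · simp_rw [volterraKer_zero, add_zero, Measure.dirac_apply' _ hB]
    rw [lintegral_indicator_one hB]
  rcases le_or_gt T a with ha | ha
  · rw [volterraKer_apply _ _ s, volterraKernel_of_le _ _ ha, lintegral_dirac' _ hmt,
      volterraKer_apply, volterraKer_apply, volterraKernel_of_le _ _ ha, volterraKernel_of_le _ _ ha]
  have hs' : (0 : ℝ) < s := hs
  have ht' : (0 : ℝ) < t := ht
  have h1 : Measurable (B.indicator (1 : ℝ → ℝ≥0∞)) := measurable_one.indicator hB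
  rw [volterraKer_apply _ _ s, lintegral_volterraKernel hlam hs' ha hmt, volterraKer_apply,
    volterraKernel_apply hlam (by positivity) ha hB]
  congr 1
  have hT : volterraKer T hlam t T B = B.indicator 1 T := by
    rw [volterraKer_apply, volterraKernel_of_le _ _ le_rfl, Measure.dirac_apply' _ hB]
  -- From the intermediate point b the process either stays below T or is absorbed during the second
  -- period; in both cases the factor ν at b cancels the normalisation of the second kernel.
  have hsplit : ∫⁻ b in Ioo a T, volterraMass lam (T - b) * gammaWeight lam s (b - a) *
        volterraKer T hlam t b B =
      (∫⁻ b in Ioo a T, ∫⁻ c in Ioo b T, gammaWeight lam s (b - a) * gammaWeight lam t (c - b) *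
        (volterraMass lam (T - c) * B.indicator 1 c)) +
      ∫⁻ b in Ioo a T, (∫⁻ r in Ioc 0 (t : ℝ), gammaWeight lam s (b - a) *
        absorptionWeight lam (T - b) r) * B.indicator 1 T := by
    rw [← lintegral_add_left]
    · refine setLIntegral_congr_fun measurableSet_Ioo fun b hb => ?_
      have hb' : 0 < T - b := sub_pos.2 hb.2
      rw [volterraKer_apply, volterraKernel_apply hlam ht' hb.2 hB,
        lintegral_const_mul _ (by fun_prop)]
      simp_rw [mul_assoc (gammaWeight lam s (b - a))]
      rw [lintegral_const_mul _ (by fun_prop), mul_comm (volterraMass lam (T - b)), ← mul_add,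
        mul_assoc, ← mul_assoc (volterraMass lam (T - b)),
        ENNReal.mul_inv_cancel (volterraMass_ne_zero hlam hb') (volterraMass_ne_top _ _), one_mul]
      congr 2
      refine lintegral_congr fun c => ?_
      ring
    · refine measurable_lintegral_Ioo_left T ?_
      simp only [Function.uncurry_def]
      fun_prop
  -- Absorption during the second period means a total lifetime in (s, s + t], which is then joined
  -- to (0, s].
  have hswap : ∫⁻ b in Ioo a T, (∫⁻ r in Ioc 0 (t : ℝ), gammaWeight lam s (b - a) *
        absorptionWeight lam (T - b) r) =
      ∫⁻ r in Ioc (s : ℝ) (s + t), absorptionWeight lam (T - a) r := by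
    rw [lintegral_lintegral_swap]
    · rw [← setLIntegral_preimage_add_left s (Ioc (s : ℝ) (s + t))]
      simp only [preimage_const_add_Ioc, sub_self, add_sub_cancel_left]
      refine setLIntegral_congr_fun measurableSet_Ioc fun r hr => ?_
      rw [setLIntegral_Ioo_eq_add_left, ← lintegral_gammaWeight_mul_absorptionWeight hlam hs'
        (by linarith [hr.1]) (sub_pos.2 ha)]
      simp only [add_sub_cancel_left, ← sub_sub]
    · simp only [Function.uncurry_def]
      exact Measurable.aemeasurable (by fun_prop)
  rw [hT, hsplit, lintegral_Ioo_Ioo_gammaWeight hlam hs' ht' (by fun_prop), lintegral_mul_const _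
    (Measurable.lintegral_prod_right' (f := fun p : ℝ × ℝ => gammaWeight lam s (p.1 - a) *
      absorptionWeight lam (T - p.1) p.2) (by fun_prop)), hswap, add_assoc,
    ← add_mul, add_comm (∫⁻ r in Ioc (s : ℝ) (s + t), _),
    ← lintegral_union measurableSet_Ioc (Ioc_disjoint_Ioc_of_le le_rfl),
    Ioc_union_Ioc_eq_Ioc hs'.le (by linarith)]
  push_cast
  congr 1
  refine lintegral_congr fun c => ?_
  ring

theorem volterraKer_Iio (T : ℝ) {lam : ℝ} (hlam : 0 < lam) (t : ℝ≥0) (a : ℝ) :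
    volterraKer T hlam t a (Iio a) = 0 := by
  rw [volterraKer_apply]
  by_cases h : 0 < (t : ℝ) ∧ a < T
  swap
  · rw [volterraKernel, if_neg h]
    simp
  rw [volterraKernel_apply hlam h.1 h.2 measurableSet_Iio,
    setLIntegral_congr_fun (g := fun _ => 0) measurableSet_Ioo]
  · simp [h.2.le]
  · intro b hb
    simp [hb.1.le]

theorem volterraKer_Ioi (T : ℝ) {lam : ℝ} (hlam : 0 < lam) (t : ℝ≥0) {a : ℝ} (ha : a ≤ T) :
    volterraKer T hlam t a (Ioi T) = 0 := by
  rw [volterraKer_apply]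
  by_cases h : 0 < (t : ℝ) ∧ a < T
  swap
  · rw [volterraKernel, if_neg h]
    simp [ha]
  rw [volterraKernel_apply hlam h.1 h.2 measurableSet_Ioi,
    setLIntegral_congr_fun (g := fun _ => 0) measurableSet_Ioo]
  · simp
  · intro b hb
    simp [hb.2.le]

/-! ### The Feller property of the Volterra kernels -/

/-- The function `y^(1/t)`, extended by its limit `0` to `t = 0`. -/
def rpowInv (y : ℝ) (t : ℝ≥0) : ℝ := if t = 0 then 0 else y ^ (t : ℝ)⁻¹

theorem rpowInv_mem_Ico {y : ℝ} (hy : y ∈ Ioo 0 1) (t : ℝ≥0) : rpowInv y t ∈ Ico 0 1 := by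
  unfold rpowInv
  split_ifs with ht
  · simp
  · have : (0 : ℝ) < t := lt_of_le_of_ne t.2 fun h => ht (NNReal.coe_injective h.symm)
    exact ⟨Real.rpow_nonneg hy.1.le _, Real.rpow_lt_one hy.1.le hy.2 (by positivity)⟩

theorem measurable_rpowInv (t : ℝ≥0) : Measurable fun y => rpowInv y t := by
  unfold rpowInv
  split_ifs
  · exact measurable_const
  · fun_prop

theorem continuous_rpowInv {y : ℝ} (hy : y ∈ Ioo 0 1) : Continuous (rpowInv y) := by
  rw [continuous_iff_continuousAt]
  intro t
  rcases eq_or_ne t 0 with rfl | ht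
  · rw [continuousAt_iff_punctured_nhds]
    have h1 : Tendsto (fun t : ℝ≥0 => (t : ℝ)⁻¹) (𝓝[≠] 0) atTop := by
      refine tendsto_inv_nhdsGT_zero.comp (tendsto_nhdsWithin_iff.2 ⟨?_, ?_⟩)
      · exact (NNReal.continuous_coe.tendsto' 0 0 rfl).mono_left nhdsWithin_le_nhds
      · filter_upwards [self_mem_nhdsWithin] with t ht
        exact NNReal.coe_pos.2 (pos_iff_ne_zero.2 ht)
    have h2 := (tendsto_rpow_atTop_of_base_lt_one y (by linarith [hy.1]) hy.2).comp h1
    have h0 : rpowInv y 0 = 0 := if_pos rfl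
    rw [h0]
    refine h2.congr' ?_
    filter_upwards [self_mem_nhdsWithin] with t ht
    exact (if_neg ht).symm
  · have h : (fun s : ℝ≥0 => y ^ (s : ℝ)⁻¹) =ᶠ[𝓝 t] rpowInv y := by
      filter_upwards [isOpen_ne.mem_nhds ht] with s hs
      exact (if_neg hs).symm
    refine ContinuousAt.congr ?_ h
    have ht' : (t : ℝ) ≠ 0 := NNReal.coe_ne_zero.2 ht
    exact ContinuousAt.rpow continuousAt_const
      (NNReal.continuous_coe.continuousAt.inv₀ ht') (Or.inl hy.1.ne')

/-- The substitution b = a + (T-a) y^(1/t) makes the domain independent of a and t, and its Jacobian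
is the inverse of the singular factor (b-a)^(t-1) up to constants. -/
theorem setIntegral_Ioo_eq_rpowInv {a T : ℝ} (ha : a < T) {t : ℝ≥0} (ht : 0 < t) (g : ℝ → ℝ) :
    ∫ b in Ioo a T, g b = ∫ y in Ioo (0 : ℝ) 1,
      ((T - a) * ((t : ℝ)⁻¹ * y ^ ((t : ℝ)⁻¹ - 1))) * g (a + (T - a) * rpowInv y t) := by
  have hτ : 0 < T - a := sub_pos.2 ha
  have ht' : (0 : ℝ) < t := ht
  have hψ : ∀ y, rpowInv y t = y ^ (t : ℝ)⁻¹ := fun y => if_neg ht.ne'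
  have himg : (fun y : ℝ => a + (T - a) * rpowInv y t) '' Ioo 0 1 = Ioo a T := by
    ext b
    constructor
    · rintro ⟨y, hy, rfl⟩
      have h1 : 0 < rpowInv y t := by rw [hψ]; exact Real.rpow_pos_of_pos hy.1 _
      have h2 := (rpowInv_mem_Ico hy t).2
      constructor <;> nlinarith
    · intro hb
      have h1 : 0 < (b - a) / (T - a) := div_pos (sub_pos.2 hb.1) hτ
      have h2 : (b - a) / (T - a) < 1 := (div_lt_one hτ).2 (by linarith [hb.2])
      refine ⟨((b - a) / (T - a)) ^ (t : ℝ),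
        ⟨Real.rpow_pos_of_pos h1 _, Real.rpow_lt_one h1.le h2 ht'⟩, ?_⟩
      simp only [hψ]
      rw [Real.rpow_rpow_inv h1.le ht'.ne']
      field_simp
      ring
  rw [← himg, integral_image_eq_integral_abs_deriv_smul
    (f' := fun y => (T - a) * ((t : ℝ)⁻¹ * y ^ ((t : ℝ)⁻¹ - 1))) measurableSet_Ioo]
  · refine setIntegral_congr_fun measurableSet_Ioo fun y hy => ?_
    have := Real.rpow_pos_of_pos hy.1 ((t : ℝ)⁻¹ - 1)
    simp only [smul_eq_mul]
    rw [abs_of_pos (by positivity)]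
  · intro y hy
    simp only [hψ]
    exact (((Real.hasDerivAt_rpow_const (Or.inl hy.1.ne')).const_mul _).const_add a).hasDerivWithinAt
  · intro y hy z hz h
    simp only [hψ, add_right_inj, mul_eq_mul_left_iff, hτ.ne', or_false] at h
    exact (Real.rpow_left_injOn (inv_ne_zero ht'.ne')) hy.1.le hz.1.le h

/-- A formula whose ingredients extend continuously to t = 0: the Jacobian factor 1/t combines with
1/Γ(t) to 1/Γ(t+1). Integrating f - f(T), which is legitimate as the kernel has mass one, removes
the atom. -/
theorem integral_volterraKernel {T lam a : ℝ} (hlam : 0 < lam) {t : ℝ≥0} (ha : a < T)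
    (f : ℝ →ᵇ ℝ) :
    ∫ b, f b ∂volterraKernel T lam t a = f T +
      (volterraNu ((T - a) * lam))⁻¹ * (((T - a) * lam) ^ (t : ℝ) / Real.Gamma (t + 1)) *
        ∫ y in Ioo (0 : ℝ) 1, (f (a + (T - a) * rpowInv y t) - f T) *
          volterraNu ((T - a) * (1 - rpowInv y t) * lam) := by
  have hτ : 0 < T - a := sub_pos.2 ha
  have hprob : IsProbabilityMeasure (volterraKernel T lam t a) := ⟨volterraKernel_univ hlam t a⟩
  have hν := volterraNu_pos (mul_pos hτ hlam)
  rcases eq_or_lt_of_le (zero_le (a := t)) with rfl | ht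
  · have h0 : ∀ y, rpowInv y 0 = 0 := fun y => if_pos rfl
    simp only [NNReal.coe_zero, volterraKernel_zero, integral_dirac, h0]
    simp
    field_simp
    ring
  have ht' : (0 : ℝ) < t := ht
  have hψ : ∀ y, rpowInv y t = y ^ (t : ℝ)⁻¹ := fun y => if_neg ht.ne'
  have hfi : Integrable f (volterraKernel T lam t a) := f.integrable _
  have hgi : Integrable (fun b => f b - f T) (volterraKernel T lam t a) :=
    hfi.sub (integrable_const _)
  have h1 : ∫ b, f b ∂volterraKernel T lam t a =
      f T + ∫ b, (f b - f T) ∂volterraKernel T lam t a := by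
    rw [integral_sub hfi (integrable_const _)]
    simp
  rw [h1, mul_assoc]
  congr 1
  have hm : Measurable fun b => ENNReal.ofReal (volterraDensity (T - a) lam t (b - a)) :=
    ((measurable_volterraDensity _ _ _).comp (measurable_id.sub_const a)).ennreal_ofReal
  rw [volterraKernel_of_pos_of_lt ht' ha] at hgi ⊢
  rw [integral_add_measure hgi.left_of_add_measure hgi.right_of_add_measure,
    integral_smul_measure, integral_dirac, sub_self, smul_zero, add_zero,
    integral_withDensity_eq_integral_toReal_smul hm (by simp), ← integral_const_mul,
    ← integral_const_mul, ← restrict_Ioo_eq_restrict_Ico, setIntegral_Ioo_eq_rpowInv ha ht]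
  refine setIntegral_congr_fun measurableSet_Ioo fun y hy => ?_
  have hψ' := rpowInv_mem_Ico hy t
  have hG : 0 < Real.Gamma t := Real.Gamma_pos_of_pos ht'
  have hψ0 : 0 < rpowInv y t := by rw [hψ]; exact Real.rpow_pos_of_pos hy.1 _
  have hν2 : 0 ≤ volterraNu ((T - a) * (1 - rpowInv y t) * lam) :=
    volterraNu_nonneg (by have := hψ'.2; have : 0 ≤ 1 - rpowInv y t := by linarith
                          positivity)
  have harg : T - a - (a + (T - a) * rpowInv y t - a) = (T - a) * (1 - rpowInv y t) := by ring
  -- The cancellation of Jacobian and singularity for which the substitution was chosen.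
  have hpow : y ^ ((t : ℝ)⁻¹ - 1) * rpowInv y t ^ ((t : ℝ) - 1) = 1 := by
    rw [hψ, ← Real.rpow_mul hy.1.le, ← Real.rpow_add hy.1]
    have : (t : ℝ)⁻¹ - 1 + (t : ℝ)⁻¹ * (t - 1) = 0 := by field_simp; ring
    rw [this, Real.rpow_zero]
  simp only [volterraDensity, smul_eq_mul]
  rw [harg, add_sub_cancel_left, ENNReal.toReal_ofReal (by positivity), Real.mul_rpow hτ.le hψ0.le,
    Real.mul_rpow hτ.le hlam.le, Real.Gamma_add_one ht'.ne']
  have hτp : (T - a) ^ (t : ℝ) = (T - a) ^ ((t : ℝ) - 1) * (T - a) := by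
    rw [← Real.rpow_add_one hτ.ne', sub_add_cancel]
  rw [hτp]
  calc _ = (y ^ ((t : ℝ)⁻¹ - 1) * rpowInv y t ^ ((t : ℝ) - 1)) *
        ((T - a) * (t : ℝ)⁻¹ * (volterraNu ((T - a) * (1 - rpowInv y t) * lam) /
          volterraNu ((T - a) * lam) * ((T - a) ^ ((t : ℝ) - 1) * lam ^ (t : ℝ) / Real.Gamma t) *
          (f (a + (T - a) * rpowInv y t) - f T))) := by ring
    _ = _ := by
      rw [hpow, one_mul]
      field_simp

/-- Dominated convergence in the formula of `integral_volterraKernel`. Starting points above the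
limit suffice for right-continuous monotone paths. The restriction bounds ν at the varying points by
its value at a₀, and for a₀ ≥ T it makes the sequence constant, so that the vanishing normalisation
ν(0) never occurs. -/
theorem tendsto_integral_volterraKer {T lam : ℝ} (hlam : 0 < lam) (f : ℝ →ᵇ ℝ) {t : ℕ → ℝ≥0}
    {a : ℕ → ℝ} {t₀ : ℝ≥0} {a₀ : ℝ} (ht : Tendsto t atTop (𝓝 t₀)) (ha : Tendsto a atTop (𝓝 a₀))
    (h : ∀ n, a n ∈ Icc a₀ T) :
    Tendsto (fun n => ∫ b, f b ∂volterraKer T hlam (t n) (a n)) atTop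
      (𝓝 (∫ b, f b ∂volterraKer T hlam t₀ a₀)) := by
  simp only [volterraKer_apply]
  rcases lt_or_ge a₀ T with hlt | hge
  swap
  · have h1 : ∀ n, a n = a₀ := fun n => le_antisymm ((h n).2.trans hge) (h n).1
    simp_rw [h1, volterraKernel_of_le _ _ hge]
    exact tendsto_const_nhds
  have hτ₀ : 0 < T - a₀ := sub_pos.2 hlt
  have hcν : ∀ {x : ℝ} {u : ℕ → ℝ}, 0 ≤ x → (∀ᶠ n in atTop, 0 ≤ u n) → Tendsto u atTop (𝓝 x) →
      Tendsto (fun n => volterraNu (u n)) atTop (𝓝 (volterraNu x)) := fun hx hu hux =>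
    (continuousOn_volterraNu _ hx).tendsto.comp (tendsto_nhdsWithin_iff.2 ⟨hux, hu⟩)
  have hev : ∀ᶠ n in atTop, a n < T := ha.eventually (Iio_mem_nhds hlt)
  have hτ : Tendsto (fun n => T - a n) atTop (𝓝 (T - a₀)) := tendsto_const_nhds.sub ha
  have htr : Tendsto (fun n => (t n : ℝ)) atTop (𝓝 t₀) :=
    (NNReal.continuous_coe.tendsto _).comp ht
  have hν₀ := volterraNu_pos (mul_pos hτ₀ hlam)
  rw [integral_volterraKernel hlam hlt]
  have heq : (fun n => f T + (volterraNu ((T - a n) * lam))⁻¹ *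
        (((T - a n) * lam) ^ (t n : ℝ) / Real.Gamma (t n + 1)) *
        ∫ y in Ioo (0 : ℝ) 1, (f (a n + (T - a n) * rpowInv y (t n)) - f T) *
          volterraNu ((T - a n) * (1 - rpowInv y (t n)) * lam)) =ᶠ[atTop]
      fun n => ∫ b, f b ∂volterraKernel T lam (t n) (a n) := by
    filter_upwards [hev] with n hn
    rw [integral_volterraKernel hlam hn]
  refine Tendsto.congr' heq (tendsto_const_nhds.add (Tendsto.mul (Tendsto.mul ?_ ?_) ?_))
  · refine (hcν (by positivity) (.of_forall fun n => ?_) (hτ.mul_const _)).inv₀ hν₀.ne'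
    have := (h n).2
    exact mul_nonneg (by linarith) hlam.le
  · have hG : 0 < Real.Gamma (t₀ + 1) := Real.Gamma_pos_of_pos (by positivity)
    refine Tendsto.div ?_ ?_ hG.ne'
    · exact (hτ.mul_const _).rpow htr (Or.inl (by positivity))
    · refine (Real.differentiableAt_Gamma fun m => ?_).continuousAt.tendsto.comp (htr.add_const 1)
      have h0 : (0 : ℝ) ≤ t₀ := t₀.2
      have h1 : (0 : ℝ) ≤ m := m.cast_nonneg
      intro h2
      linarith
  · refine tendsto_integral_filter_of_dominated_convergence
      (fun _ => (2 * ‖f‖) * volterraNu ((T - a₀) * lam)) (.of_forall fun n => ?_)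
      (.of_forall fun n => ?_) (integrable_const _) ?_
    · have h1 := measurable_volterraNu
      have h2 := measurable_rpowInv (t n)
      have h3 := f.continuous.measurable
      exact Measurable.aestronglyMeasurable (by fun_prop)
    · refine (ae_restrict_mem measurableSet_Ioo).mono fun y hy => ?_
      have h1 := rpowInv_mem_Ico hy (t n)
      have h2 : 0 ≤ T - a n := sub_nonneg.2 (h n).2
      have h3 : 0 ≤ 1 - rpowInv y (t n) := by linarith [h1.2]
      have h4 : 0 ≤ (T - a n) * (1 - rpowInv y (t n)) * lam := by positivity
      rw [norm_mul, Real.norm_of_nonneg (volterraNu_nonneg h4)]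
      refine mul_le_mul ?_ (volterraNu_mono h4 ?_) (volterraNu_nonneg h4) (by positivity)
      · refine (norm_sub_le _ _).trans ?_
        linarith [f.norm_coe_le_norm (a n + (T - a n) * rpowInv y (t n)), f.norm_coe_le_norm T]
      · refine mul_le_mul_of_nonneg_right ?_ hlam.le
        nlinarith [h1.1, (h n).1]
    · refine (ae_restrict_mem measurableSet_Ioo).mono fun y hy => ?_
      have hψ : Tendsto (fun n => rpowInv y (t n)) atTop (𝓝 (rpowInv y t₀)) :=
        ((continuous_rpowInv hy).tendsto _).comp ht
      refine Tendsto.mul (((f.continuous.tendsto _).comp (ha.add (hτ.mul hψ))).sub_const _)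
        (hcν ?_ (.of_forall fun n => ?_) ((hτ.mul (hψ.const_sub 1)).mul_const _))
      · have := (rpowInv_mem_Ico hy t₀).2
        have h3 : 0 ≤ 1 - rpowInv y t₀ := by linarith
        positivity
      · have h1 := rpowInv_mem_Ico hy (t n)
        have h2 : 0 ≤ T - a n := sub_nonneg.2 (h n).2
        have h3 : 0 ≤ 1 - rpowInv y (t n) := by linarith [h1.2]
        positivity

/-! ### Markov processes with prescribed transition kernels -/

section MarkovLaw

variable {ι Ω Ω' E : Type*} [MeasurableSpace E]

/-- The `σ`-algebra generated by a process up to a given time. -/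
abbrev pastSigma [Preorder ι] (X : ι → Ω → E) (s : ι) : MeasurableSpace Ω :=
  ⨆ j ≤ s, MeasurableSpace.comap (X j) inferInstance

theorem measurable_pastSigma [Preorder ι] (X : ι → Ω → E) {j s : ι} (h : j ≤ s) :
    @Measurable _ _ (pastSigma X s) _ (X j) :=
  measurable_iff_comap_le.2 (le_iSup₂_of_le j h le_rfl)

theorem pastSigma_mono [Preorder ι] (X : ι → Ω → E) {s t : ι} (h : s ≤ t) :
    pastSigma X s ≤ pastSigma X t :=
  iSup₂_le fun _ hj => measurable_iff_comap_le.1 (measurable_pastSigma X (hj.trans h))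

theorem pastSigma_le [Preorder ι] [mΩ : MeasurableSpace Ω] {X : ι → Ω → E}
    (hX : ∀ i, Measurable (X i)) (s : ι) : pastSigma X s ≤ mΩ :=
  iSup₂_le fun j _ => measurable_iff_comap_le.1 (hX j)

theorem exists_preimage_of_measurableSet_pastSigma [Preorder ι] {X : ι → Ω → E} {s : ι}
    {A : Set Ω} (hA : MeasurableSet[pastSigma X s] A) :
    ∃ S : Set (Iic s → E), MeasurableSet S ∧ (fun ω (j : Iic s) => X j ω) ⁻¹' S = A := by
  have h : pastSigma X s = MeasurableSpace.comap (fun ω (j : Iic s) => X j ω) inferInstance := by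
    rw [MeasurableSpace.comap_process_pi, pastSigma, iSup_subtype']
    rfl
  rw [h] at hA
  exact hA

/-- The process `X` is Markovian under `P` with respect to its own filtration, with transition
kernels `K s t` from time `s` to time `t`. -/
def IsMarkovLaw [Preorder ι] [MeasurableSpace Ω] (X : ι → Ω → E) (K : ι → ι → Kernel E E)
    (P : Measure Ω) : Prop :=
  ∀ s t, s ≤ t → ∀ A, MeasurableSet[pastSigma X s] A → ∀ B, MeasurableSet B →
    P (A ∩ X t ⁻¹' B) = ∫⁻ ω in A, K s t (X s ω) B ∂P

theorem IsMarkovLaw.lintegral_eq [Preorder ι] [MeasurableSpace Ω] {X : ι → Ω → E}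
    {K : ι → ι → Kernel E E} {P : Measure Ω} (h : IsMarkovLaw X K P) (hX : ∀ i, Measurable (X i))
    {s t : ι} (hst : s ≤ t) {A : Set Ω} (hA : MeasurableSet[pastSigma X s] A) {f : E → ℝ≥0∞}
    (hf : Measurable f) :
    ∫⁻ ω in A, f (X t ω) ∂P = ∫⁻ ω in A, ∫⁻ y, f y ∂K s t (X s ω) ∂P := by
  have hbind : (P.restrict A).map (X t) = ((P.restrict A).map (X s)).bind (K s t) := by
    ext B hB
    rw [Measure.map_apply (hX t) hB, Measure.restrict_apply (hX t hB), inter_comm,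
      h s t hst A hA B hB, Measure.bind_apply hB (K s t).measurable.aemeasurable,
      lintegral_map ((K s t).measurable_coe hB) (hX s)]
  rw [← lintegral_map hf (hX t), hbind, Measure.lintegral_bind (K s t).measurable.aemeasurable
    hf.aemeasurable, lintegral_map hf.lintegral_kernel (hX s)]

/-- A Markov law is determined by its initial law and its transition kernels. -/
theorem IsMarkovLaw.map_eq [LinearOrder ι] [OrderBot ι] [MeasurableSpace Ω] [MeasurableSpace Ω']
    {X : ι → Ω → E} {X' : ι → Ω' → E} {K : ι → ι → Kernel E E} {P : Measure Ω} {P' : Measure Ω'}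
    [IsFiniteMeasure P] [IsFiniteMeasure P'] (hX : ∀ i, Measurable (X i))
    (hX' : ∀ i, Measurable (X' i)) (h : IsMarkovLaw X K P) (h' : IsMarkovLaw X' K P')
    (h0 : P.map (X ⊥) = P'.map (X' ⊥)) :
    P.map (fun ω i => X i ω) = P'.map (fun ω i => X' i ω) := by
  classical
  have hXm : Measurable fun ω i => X i ω := measurable_pi_lambda _ hX
  have hXm' : Measurable fun ω i => X' i ω := measurable_pi_lambda _ hX'
  have hr : ∀ J : Finset ι, Measurable fun ω (j : J) => X j ω := fun J =>
    measurable_pi_lambda _ fun j => hX j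
  have hr' : ∀ J : Finset ι, Measurable fun ω (j : J) => X' j ω := fun J =>
    measurable_pi_lambda _ fun j => hX' j
  -- Times are added in increasing order, and ⊥ is always included so that there is an earlier time
  -- at which to apply the Markov property.
  have key : ∀ J : Finset ι, P.map (fun ω (j : (insert ⊥ J : Finset ι)) => X j ω) =
      P'.map (fun ω (j : (insert ⊥ J : Finset ι)) => X' j ω) := by
    intro J
    induction J using Finset.induction_on_max with
    | empty =>
      let g : E → ((insert ⊥ (∅ : Finset ι) : Finset ι) → E) := fun x _ => x
      have hg : Measurable g := measurable_pi_lambda _ fun _ => measurable_id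
      have e : (fun ω (j : (insert ⊥ (∅ : Finset ι) : Finset ι)) => X j ω) = g ∘ X ⊥ := by
        funext ω j
        have : (j : ι) = ⊥ := by simpa using j.2
        simp [g, this]
      have e' : (fun ω (j : (insert ⊥ (∅ : Finset ι) : Finset ι)) => X' j ω) = g ∘ X' ⊥ := by
        funext ω j
        have : (j : ι) = ⊥ := by simpa using j.2
        simp [g, this]
      rw [e, e', ← Measure.map_map hg (hX _), ← Measure.map_map hg (hX' _), h0]
    | insert u J hu ih =>
      let J' : Finset ι := insert ⊥ J
      have hne : J'.Nonempty := ⟨⊥, Finset.mem_insert_self _ _⟩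
      -- Conditioning at the latest earlier time makes all of `J'` part of the past, and the new
      -- coordinate depends on it only through the coordinate at s.
      let s := J'.max' hne
      have hsu : s ≤ u := Finset.max'_le _ _ _ fun j hj => by
        rcases Finset.mem_insert.1 hj with rfl | hj
        · exact bot_le
        · exact (hu j hj).le
      have hle : ∀ j : J', (j : ι) ≤ s := fun j => Finset.le_max' _ _ j.2
      have hsJ : s ∈ J' := Finset.max'_mem _ _
      have hpair : P.map (fun ω => ((fun j : J' => X j ω), X u ω)) =
          P'.map (fun ω => ((fun j : J' => X' j ω), X' u ω)) := by
        refine Measure.ext_prod fun {S B} hS hB => ?_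
        have hK : Measurable fun x : J' → E => K s u (x ⟨s, hsJ⟩) B :=
          ((K s u).measurable_coe hB).comp (measurable_pi_apply _)
        have aux1 : P ((fun ω (j : J') => X j ω) ⁻¹' S ∩ X u ⁻¹' B) =
            ∫⁻ x in S, K s u (x ⟨s, hsJ⟩) B ∂P.map (fun ω (j : J') => X j ω) := by
          rw [h s u hsu _ ?_ B hB, setLIntegral_map hS hK (hr J')]
          exact (@measurable_pi_iff _ _ _ (pastSigma X s) _ _).2
            (fun j => measurable_pastSigma X (hle j)) hS
        have aux2 : P' ((fun ω (j : J') => X' j ω) ⁻¹' S ∩ X' u ⁻¹' B) =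
            ∫⁻ x in S, K s u (x ⟨s, hsJ⟩) B ∂P'.map (fun ω (j : J') => X' j ω) := by
          rw [h' s u hsu _ ?_ B hB, setLIntegral_map hS hK (hr' J')]
          exact (@measurable_pi_iff _ _ _ (pastSigma X' s) _ _).2
            (fun j => measurable_pastSigma X' (hle j)) hS
        rw [Measure.map_apply ((hr J').prodMk (hX u)) (hS.prod hB),
          Measure.map_apply ((hr' J').prodMk (hX' u)) (hS.prod hB), mk_preimage_prod,
          mk_preimage_prod, aux1, aux2, ih]
      let g : (J' → E) × E → ((insert ⊥ (insert u J) : Finset ι) → E) := fun p j =>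
        if hj : (j : ι) ∈ J' then p.1 ⟨j, hj⟩ else p.2
      have hg : Measurable g := by
        refine measurable_pi_lambda _ fun j => ?_
        by_cases hj : (j : ι) ∈ J'
        · simp only [g, hj, dif_pos]
          exact (measurable_pi_apply _).comp measurable_fst
        · simp only [g, hj, dif_neg, not_false_eq_true]
          exact measurable_snd
      have hju : ∀ j : (insert ⊥ (insert u J) : Finset ι), (j : ι) ∉ J' → (j : ι) = u := by
        intro j hj
        have := j.2
        simp only [J', Finset.mem_insert, not_or] at this hj
        tauto
      have e : (fun ω (j : (insert ⊥ (insert u J) : Finset ι)) => X j ω) =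
          g ∘ fun ω => ((fun j : J' => X j ω), X u ω) := by
        funext ω j
        by_cases hj : (j : ι) ∈ J'
        · simp [g, hj]
        · simp [g, hju j hj]
      have e' : (fun ω (j : (insert ⊥ (insert u J) : Finset ι)) => X' j ω) =
          g ∘ fun ω => ((fun j : J' => X' j ω), X' u ω) := by
        funext ω j
        by_cases hj : (j : ι) ∈ J'
        · simp [g, hj]
        · simp [g, hju j hj]
      rw [e, e', ← Measure.map_map hg ((hr J').prodMk (hX u)),
        ← Measure.map_map hg ((hr' J').prodMk (hX' u)), hpair]
  have hproj : ∀ J : Finset ι, (P.map (fun ω i => X i ω)).map J.restrict =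
      (P'.map (fun ω i => X' i ω)).map J.restrict := by
    intro J
    rw [Measure.map_map (Finset.measurable_restrict _) hXm,
      Measure.map_map (Finset.measurable_restrict _) hXm']
    have hsub : J ⊆ insert ⊥ J := Finset.subset_insert _ _
    let g : ((insert ⊥ J : Finset ι) → E) → (J → E) := fun x j => x ⟨j, hsub j.2⟩
    have hg : Measurable g := measurable_pi_lambda _ fun j => measurable_pi_apply _
    have h1 := congrArg (Measure.map g) (key J)
    rw [Measure.map_map hg (hr _), Measure.map_map hg (hr' _)] at h1
    exact h1
  exact IsProjectiveLimit.unique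
    (P := fun J : Finset ι => (P'.map (fun ω i => X' i ω)).map J.restrict) hproj fun _ => rfl

/-- A Markov chain with given one-step kernels and given initial law exists. -/
theorem exists_markovChain (K : ℕ → Kernel E E) [∀ n, IsMarkovKernel (K n)] (μ : Measure E)
    [IsProbabilityMeasure μ] :
    ∃ Q : Measure (ℕ → E), IsProbabilityMeasure Q ∧ Q.map (fun x => x 0) = μ ∧
      ∀ n A, MeasurableSet[pastSigma (fun n (x : ℕ → E) => x n) n] A → ∀ B, MeasurableSet B →
        Q (A ∩ (fun x => x (n + 1)) ⁻¹' B) = ∫⁻ x in A, K n (x n) B ∂Q := by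
  -- The Ionescu-Tulcea kernels may read the whole history; these read only its last entry.
  let κ : (n : ℕ) → Kernel ((i : Finset.Iic n) → E) E := fun n =>
    (K n).comap (fun x => x ⟨n, Finset.mem_Iic.2 le_rfl⟩) (measurable_pi_apply _)
  have hκ : ∀ n, IsMarkovKernel (κ n) := fun n => inferInstance
  refine ⟨Kernel.trajMeasure (X := fun _ => E) μ κ, inferInstance, ?_, ?_⟩
  · have h0 : (fun x : ℕ → E => x 0) =
        (fun x : (i : Finset.Iic 0) → E => x ⟨0, Finset.mem_Iic.2 le_rfl⟩) ∘
          Preorder.frestrictLe (π := fun _ => E) 0 := rfl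
    have hp : Measurable fun x : (i : Finset.Iic 0) → E => x ⟨0, Finset.mem_Iic.2 le_rfl⟩ :=
      measurable_pi_apply _
    rw [h0, ← Measure.map_map hp (Preorder.measurable_frestrictLe 0),
      Kernel.trajMeasure, Measure.map_comp _ _ (Preorder.measurable_frestrictLe 0),
      Kernel.traj_map_frestrictLe, Kernel.partialTraj_self, Measure.id_comp,
      Measure.map_map hp (MeasurableEquiv.measurable _)]
    exact Measure.map_id
  · intro n A hA B hB
    obtain ⟨S, hS, rfl⟩ := exists_preimage_of_measurableSet_pastSigma hA
    have hkey := Kernel.map_frestrictLe_trajMeasure_compProd_eq_map_trajMeasure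
      (X := fun _ => E) (μ₀ := μ) (κ := κ) (a := n)
    have hsub : ∀ i : Iic n, (i : ℕ) ∈ Finset.Iic n := fun i => Finset.mem_Iic.2 i.2
    let g : ((i : Finset.Iic n) → E) → (Iic n → E) := fun x i => x ⟨i, hsub i⟩
    have hg : Measurable g := measurable_pi_lambda _ fun i => measurable_pi_apply _
    have hr : Measurable (Preorder.frestrictLe (π := fun _ : ℕ => E) n) :=
      Preorder.measurable_frestrictLe n
    have h1 := congrArg (fun ρ => ρ ((g ⁻¹' S) ×ˢ B)) hkey
    rw [Measure.compProd_apply_prod (hg hS) hB, Measure.map_apply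
      (hr.prodMk (measurable_pi_apply _)) ((hg hS).prod hB), setLIntegral_map (hg hS)
      ((κ n).measurable_coe hB) hr] at h1
    exact h1.symm

/-- One-step transition probabilities of a chain determine all of them. -/
theorem isMarkovLaw_of_succ [MeasurableSpace Ω] {X : ℕ → Ω → E} (hX : ∀ n, Measurable (X n))
    {K : ℕ → ℕ → Kernel E E} (hK0 : ∀ n a, K n n a = Measure.dirac a)
    (hK : ∀ m n, m ≤ n → K m (n + 1) = K n (n + 1) ∘ₖ K m n) {P : Measure Ω}
    (h : ∀ n A, MeasurableSet[pastSigma X n] A → ∀ B, MeasurableSet B →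
        P (A ∩ X (n + 1) ⁻¹' B) = ∫⁻ ω in A, K n (n + 1) (X n ω) B ∂P) :
    IsMarkovLaw X K P := by
  intro m n hmn
  induction n, hmn using Nat.le_induction with
  | base =>
    intro A hA B hB
    have : ∀ ω, K m m (X m ω) B = (X m ⁻¹' B).indicator 1 ω := fun ω => by
      rw [hK0, Measure.dirac_apply' _ hB]; rfl
    simp_rw [this]
    rw [lintegral_indicator_one (hX m hB), Measure.restrict_apply (hX m hB), inter_comm]
  | succ n hmn ih =>
    intro A hA B hB
    have hbind : (P.restrict A).map (X n) = ((P.restrict A).map (X m)).bind (K m n) := by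
      ext B hB
      rw [Measure.map_apply (hX n) hB, Measure.restrict_apply (hX n hB), inter_comm,
        ih A hA B hB, Measure.bind_apply hB (K m n).measurable.aemeasurable,
        lintegral_map ((K m n).measurable_coe hB) (hX m)]
    have hm := (K n (n + 1)).measurable_coe hB
    rw [h n A (pastSigma_mono X hmn A hA) B hB, ← lintegral_map hm (hX n), hbind,
      Measure.lintegral_bind (K m n).measurable.aemeasurable hm.aemeasurable,
      lintegral_map hm.lintegral_kernel (hX m)]
    simp_rw [hK m n hmn, Kernel.comp_apply' _ _ _ hB]

end MarkovLaw

/-! ### Finite-dimensional and monotonicity criteria for Markov laws -/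

section MarkovLaw

variable {ι Ω E : Type*} [MeasurableSpace E]

/-- Rectangles suffice. Here Z is any statistic of the past which determines the state at s. -/
theorem IsMarkovLaw.map_prod_eq [Preorder ι] [MeasurableSpace Ω] {X : ι → Ω → E}
    {K : ι → ι → Kernel E E} [∀ s t, IsMarkovKernel (K s t)] {P : Measure Ω} [IsFiniteMeasure P]
    (h : IsMarkovLaw X K P) (hX : ∀ i, Measurable (X i)) {s t : ι} (hst : s ≤ t) {β : Type*}
    [MeasurableSpace β] {Z : Ω → β} (hZ : @Measurable _ _ (pastSigma X s) _ Z) {z : β → E}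
    (hz : Measurable z) (hzZ : ∀ ω, z (Z ω) = X s ω) :
    P.map (fun ω => (Z ω, X t ω)) = (P.map Z) ⊗ₘ ((K s t).comap z hz) := by
  have hZ' : Measurable Z := hZ.mono (pastSigma_le hX s) le_rfl
  refine Measure.ext_prod fun {S B} hS hB => ?_
  rw [Measure.map_apply (hZ'.prodMk (hX t)) (hS.prod hB), mk_preimage_prod,
    h s t hst _ (hZ hS) B hB, Measure.compProd_apply_prod hS hB,
    setLIntegral_map hS (((K s t).comap z hz).measurable_coe hB) hZ']
  simp_rw [Kernel.comap_apply, hzZ]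

/-- For fixed B, both sides of the Markov identity are measures in A on the past σ-algebra. They
agree on cylinders over finitely many times, which form a generating π-system. -/
theorem isMarkovLaw_of_finset [Preorder ι] [MeasurableSpace Ω] {X : ι → Ω → E}
    (hX : ∀ i, Measurable (X i)) {K : ι → ι → Kernel E E} [∀ s t, IsMarkovKernel (K s t)]
    {P : Measure Ω} [IsFiniteMeasure P]
    (h : ∀ s t, s ≤ t → ∀ (I : Finset ι) (hs : s ∈ I), (∀ j ∈ I, j ≤ s) →
      P.map (fun ω => ((fun j : I => X j ω), X t ω)) =
        (P.map fun ω (j : I) => X j ω) ⊗ₘ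
          ((K s t).comap (fun x => x ⟨s, hs⟩) (measurable_pi_apply _))) :
    IsMarkovLaw X K P := by
  classical
  intro s t hst A hA B hB
  have hm := pastSigma_le hX s
  have hfd : ∀ (I : Finset ι), s ∈ I → (∀ j ∈ I, j ≤ s) → ∀ S : Set (I → E), MeasurableSet S →
      P ((fun ω (j : I) => X j ω) ⁻¹' S ∩ X t ⁻¹' B) =
        ∫⁻ ω in (fun ω (j : I) => X j ω) ⁻¹' S, K s t (X s ω) B ∂P := by
    intro I hsI hI S hS
    have hXI : Measurable fun ω (j : I) => X j ω := measurable_pi_lambda _ fun j => hX j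
    have h1 := congrArg (fun ρ => ρ (S ×ˢ B)) (h s t hst I hsI hI)
    rw [Measure.map_apply (hXI.prodMk (hX t)) (hS.prod hB), mk_preimage_prod,
      Measure.compProd_apply_prod hS hB, setLIntegral_map hS (Kernel.measurable_coe _ hB) hXI] at h1
    exact h1
  let ν₁ : @Measure Ω (pastSigma X s) := (P.restrict (X t ⁻¹' B)).trim hm
  let ν₂ : @Measure Ω (pastSigma X s) := (P.withDensity fun ω => K s t (X s ω) B).trim hm
  have hν₁ : ∀ A, MeasurableSet[pastSigma X s] A → ν₁ A = P (A ∩ X t ⁻¹' B) := fun A hA => by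
    rw [trim_measurableSet_eq hm hA, Measure.restrict_apply (hm A hA)]
  have hν₂ : ∀ A, MeasurableSet[pastSigma X s] A → ν₂ A = ∫⁻ ω in A, K s t (X s ω) B ∂P :=
    fun A hA => by rw [trim_measurableSet_eq hm hA, withDensity_apply _ (hm A hA)]
  suffices hν : ν₁ = ν₂ by rw [← hν₁ A hA, hν, hν₂ A hA]
  have hfin₁ : IsFiniteMeasure ν₁ := isFiniteMeasure_trim hm
  have hcyl : ∀ (J : Finset ι), (↑J ⊆ Iic s) → ∀ f : ι → Set Ω,
      (∀ j ∈ J, MeasurableSet[MeasurableSpace.comap (X j) inferInstance] (f j)) →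
      ν₁ (⋂ j ∈ J, f j) = ν₂ (⋂ j ∈ J, f j) := by
    intro J hJ f hf
    -- The time s is adjoined so that the argument of the kernel is one of the coordinates.
    have hI : ∀ j ∈ insert s J, j ≤ s := by
      intro j hj
      rcases Finset.mem_insert.1 hj with rfl | hj
      · exact le_rfl
      · exact hJ hj
    have hmeas : MeasurableSet[MeasurableSpace.comap
        (fun ω (j : (insert s J : Finset ι)) => X j ω) inferInstance] (⋂ j ∈ J, f j) := by
      refine Finset.measurableSet_biInter _ fun j hj => ?_
      obtain ⟨S, hS, hSf⟩ := hf j hj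
      exact ⟨(fun x => x ⟨j, Finset.mem_insert_of_mem hj⟩) ⁻¹' S, measurable_pi_apply _ hS, hSf⟩
    have hpast : MeasurableSet[pastSigma X s] (⋂ j ∈ J, f j) := by
      refine Finset.measurableSet_biInter _ fun j hj => ?_
      exact measurable_iff_comap_le.1 (measurable_pastSigma X (hJ hj)) _ (hf j hj)
    obtain ⟨S, hS, hSA⟩ := hmeas
    rw [hν₁ _ hpast, hν₂ _ hpast, ← hSA]
    exact hfd _ (Finset.mem_insert_self _ _) hI S hS
  refine ext_of_generate_finite (piiUnionInter
    (fun j => {S | MeasurableSet[MeasurableSpace.comap (X j) inferInstance] S}) (Iic s)) ?_ ?_ ?_ ?_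
  · exact (generateFrom_piiUnionInter_measurableSet
      (fun j => MeasurableSpace.comap (X j) inferInstance) (Iic s)).symm
  · exact isPiSystem_piiUnionInter _ (fun j => @MeasurableSpace.isPiSystem_measurableSet _ (_)) _
  · rintro A ⟨J, hJ, f, hf, rfl⟩
    exact hcyl J hJ f hf
  · simpa using hcyl ∅ (by simp) (fun _ => univ) (by simp)

/-- A strict decrease would cross some rational level c, and for each of these countably many levels
the Markov property gives probability zero. -/
theorem IsMarkovLaw.ae_le [Preorder ι] [MeasurableSpace Ω] {X : ι → Ω → ℝ}
    {K : ι → ι → Kernel ℝ ℝ} {P : Measure Ω} (h : IsMarkovLaw X K P) (hX : ∀ i, Measurable (X i))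
    {s t : ι} (hst : s ≤ t) (hK : ∀ a, K s t a (Iio a) = 0) : ∀ᵐ ω ∂P, X s ω ≤ X t ω := by
  have hc : ∀ c : ℚ, ∀ᵐ ω ∂P, ¬ ((c : ℝ) ≤ X s ω ∧ X t ω < c) := by
    intro c
    have hA := measurable_pastSigma X (le_refl s) (measurableSet_Ici (a := (c : ℝ)))
    have h1 := h s t hst _ hA (Iio (c : ℝ)) measurableSet_Iio
    rw [setLIntegral_congr_fun (g := fun _ => 0) (hX s measurableSet_Ici)
      (fun ω hω => measure_mono_null (Iio_subset_Iio hω) (hK (X s ω))), lintegral_zero] at h1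
    exact measure_eq_zero_iff_ae_notMem.1 h1
  filter_upwards [ae_all_iff.2 hc] with ω hω
  by_contra hlt
  obtain ⟨c, hc1, hc2⟩ := exists_rat_btwn (not_le.1 hlt)
  exact hω c ⟨hc2.le, hc1⟩

theorem IsMarkovLaw.ae_le_const [Preorder ι] [MeasurableSpace Ω] {X : ι → Ω → ℝ}
    {K : ι → ι → Kernel ℝ ℝ} {P : Measure Ω} (h : IsMarkovLaw X K P) {s t : ι} (hst : s ≤ t)
    {T : ℝ} (hK : ∀ a ≤ T, K s t a (Ioi T) = 0) (hs : ∀ᵐ ω ∂P, X s ω ≤ T) :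
    ∀ᵐ ω ∂P, X t ω ≤ T := by
  have h1 := h s t hst univ MeasurableSet.univ (Ioi T) measurableSet_Ioi
  rw [Measure.restrict_univ, lintegral_congr_ae (g := fun _ => 0)
    (hs.mono fun ω hω => hK _ hω), lintegral_zero, univ_inter] at h1
  filter_upwards [measure_eq_zero_iff_ae_notMem.1 h1] with ω hω
  exact not_lt.1 hω

end MarkovLaw

/-- A sequence of laws, each the image of the next one under a fixed map, comes from a single
random sequence. -/
theorem exists_inverseLimit {E : Type*} [MeasurableSpace E] [StandardBorelSpace E] [Nonempty E]
    {θ : E → E} (hθ : Measurable θ) (Q : ℕ → Measure E) [∀ n, IsProbabilityMeasure (Q n)]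
    (h : ∀ n, (Q (n + 1)).map θ = Q n) :
    ∃ R : Measure (ℕ → E), IsProbabilityMeasure R ∧ (∀ n, R.map (fun x => x n) = Q n) ∧
      ∀ n, ∀ᵐ x ∂ R, θ (x (n + 1)) = x n := by
  -- The chain runs backwards through θ: given the nth term, the next one is drawn from the
  -- conditional law of a `Q (n + 1)`-sample given its image under θ.
  obtain ⟨R, hR, hR0, hRs⟩ := exists_markovChain
    (fun n => condDistrib (fun x : E => x) θ (Q (n + 1))) (Q 0)
  have hE : ∀ n, Measurable fun x : ℕ → E => x n := fun n => measurable_pi_apply n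
  have hstep : ∀ n, R.map (fun x => x n) = Q n →
      R.map (fun x => (x n, x (n + 1))) = (Q (n + 1)).map (fun x => (θ x, x)) := by
    intro n hn
    refine Measure.ext_prod fun {S B} hS hB => ?_
    rw [← compProd_map_condDistrib (X := θ) measurable_id'.aemeasurable, h n,
      Measure.compProd_apply_prod hS hB, Measure.map_apply
        ((hE n).prodMk (hE (n + 1))) (hS.prod hB),
      mk_preimage_prod, hRs n _ (measurable_pastSigma _ le_rfl hS) B hB, ← hn,
      setLIntegral_map hS (Kernel.measurable_coe _ hB) (hE n)]
  have hlaw : ∀ n, R.map (fun x => x n) = Q n := by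
    intro n
    induction n with
    | zero => exact hR0
    | succ n ih =>
      have h1 := congrArg (Measure.map Prod.snd) (hstep n ih)
      rw [Measure.map_map measurable_snd
        ((hE n).prodMk (hE (n + 1))),
        Measure.map_map measurable_snd (hθ.prodMk measurable_id')] at h1
      exact h1.trans Measure.map_id
  refine ⟨R, hR, hlaw, fun n => ?_⟩
  have hD : MeasurableSet {p : E × E | θ p.2 = p.1} :=
    measurableSet_eq_fun (hθ.comp measurable_snd) measurable_fst
  have h1 : ∀ᵐ p ∂(R.map (fun x => (x n, x (n + 1)))), θ p.2 = p.1 := by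
    rw [hstep n (hlaw n), ae_map_iff (hθ.prodMk measurable_id').aemeasurable hD]
    exact .of_forall fun _ => rfl
  exact (ae_map_iff ((hE n).prodMk (hE (n + 1))).aemeasurable
    hD).1 h1

/-! ### Monotone cadlag paths from their values at dyadic times -/

/-- The index `k` of the first dyadic time `k / 2^m` after `t`. -/
def dyadicIndex (m : ℕ) (t : ℝ≥0) : ℕ := ⌊t * 2 ^ m⌋₊ + 1

/-- Strict even when t is dyadic. This makes the grid point serve a whole right neighbourhood of t,
hence yields right-continuity of the limit path. -/
theorem lt_dyadicIndex (m : ℕ) (t : ℝ≥0) : t * 2 ^ m < dyadicIndex m t := by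
  simpa [dyadicIndex] using Nat.lt_floor_add_one (t * 2 ^ m)

theorem dyadicIndex_le (m : ℕ) (t : ℝ≥0) : (dyadicIndex m t : ℝ≥0) ≤ t * 2 ^ m + 1 := by
  simpa [dyadicIndex] using Nat.floor_le (zero_le (a := t * 2 ^ m))

theorem dyadicIndex_mono (m : ℕ) : Monotone (dyadicIndex m) := fun s t h => by
  unfold dyadicIndex
  gcongr

theorem dyadicIndex_le_of_lt {m k : ℕ} {t : ℝ≥0} (h : t * 2 ^ m < k) : dyadicIndex m t ≤ k :=
  Nat.succ_le_of_lt ((Nat.floor_lt (zero_le (a := t * 2 ^ m))).2 h)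

/-- The first grid point after t moves left under refinement, so the values of a nondecreasing path
there decrease. -/
theorem dyadicIndex_succ_le (m : ℕ) (t : ℝ≥0) : dyadicIndex (m + 1) t ≤ 2 * dyadicIndex m t := by
  refine dyadicIndex_le_of_lt ?_
  have := lt_dyadicIndex m t
  push_cast
  calc t * 2 ^ (m + 1) = 2 * (t * 2 ^ m) := by ring
    _ < _ := by gcongr

/-- Each index exceeds 2^m times its time by an amount in (0, 1], so the difference of two indices
errs by at most one and the quotient by at most 2^(-m). -/
theorem tendsto_dyadicIndex_sub_div {s t : ℝ≥0} :
    Tendsto (fun m => ((dyadicIndex m (s + t) - dyadicIndex m s : ℕ) : ℝ≥0) / 2 ^ m) atTop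
      (𝓝 t) := by
  have h2 : Tendsto (fun m : ℕ => ((1 : ℝ) / 2) ^ m) atTop (𝓝 0) :=
    tendsto_pow_atTop_nhds_zero_of_lt_one (by norm_num) (by norm_num)
  rw [← NNReal.tendsto_coe]
  refine tendsto_of_tendsto_of_tendsto_of_le_of_le (g := fun m => (t : ℝ) - (1 / 2) ^ m)
    (h := fun m => (t : ℝ) + (1 / 2) ^ m) (by simpa using tendsto_const_nhds.sub h2)
    (by simpa using tendsto_const_nhds.add h2) (fun m => ?_) fun m => ?_
  all_goals
    have hp : (0 : ℝ) < 2 ^ m := by positivity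
    have hmono := dyadicIndex_mono m (le_add_of_nonneg_right (zero_le (a := t)) : s ≤ s + t)
    have h1 := NNReal.coe_lt_coe.2 (lt_dyadicIndex m (s + t))
    have h3 := NNReal.coe_le_coe.2 (dyadicIndex_le m (s + t))
    have h4 := NNReal.coe_lt_coe.2 (lt_dyadicIndex m s)
    have h5 := NNReal.coe_le_coe.2 (dyadicIndex_le m s)
    push_cast at h1 h3 h4 h5
    rw [NNReal.coe_div, NNReal.coe_natCast, Nat.cast_sub hmono]
    simp only [one_div, inv_pow]
    push_cast
  · rw [le_div_iff₀ hp, sub_mul, inv_mul_cancel₀ hp.ne']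
    linarith
  · rw [div_le_iff₀ hp, add_mul, inv_mul_cancel₀ hp.ne']
    linarith

/-- Values `x m k` at the dyadic times `k / 2^m` of a nondecreasing function bounded by `T`. -/
structure IsDyadicPath (T : ℝ) (x : ℕ → ℕ → ℝ) : Prop where
  consistent : ∀ m k, x (m + 1) (2 * k) = x m k
  le_succ : ∀ m k, x m k ≤ x m (k + 1)
  le_const : ∀ m k, x m k ≤ T

/-- The right-continuous function determined by values at dyadic times. -/
def dyadicLimit (x : ℕ → ℕ → ℝ) (t : ℝ≥0) : ℝ := ⨅ m, x m (dyadicIndex m t)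

namespace IsDyadicPath

variable {T : ℝ} {x : ℕ → ℕ → ℝ}

theorem mono (h : IsDyadicPath T x) (m : ℕ) : Monotone (x m) :=
  monotone_nat_of_le_succ (h.le_succ m)

theorem apply_zero (h : IsDyadicPath T x) (m : ℕ) : x m 0 = x 0 0 := by
  induction m with
  | zero => rfl
  | succ m ih => rw [← ih, ← h.consistent m 0]

theorem antitone (h : IsDyadicPath T x) (t : ℝ≥0) :
    Antitone fun m => x m (dyadicIndex m t) :=
  antitone_nat_of_succ_le fun m =>
    (h.mono (m + 1) (dyadicIndex_succ_le m t)).trans_eq (h.consistent m _)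

theorem bddBelow (h : IsDyadicPath T x) (t : ℝ≥0) :
    BddBelow (range fun m => x m (dyadicIndex m t)) :=
  ⟨x 0 0, by rintro _ ⟨m, rfl⟩; rw [← h.apply_zero m]; exact h.mono m (Nat.zero_le _)⟩

theorem dyadicLimit_le (h : IsDyadicPath T x) (m : ℕ) (t : ℝ≥0) :
    dyadicLimit x t ≤ x m (dyadicIndex m t) := ciInf_le (h.bddBelow t) m

theorem tendsto_dyadicLimit (h : IsDyadicPath T x) (t : ℝ≥0) :
    Tendsto (fun m => x m (dyadicIndex m t)) atTop (𝓝 (dyadicLimit x t)) :=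
  tendsto_atTop_ciInf (h.antitone t) (h.bddBelow t)

theorem monotone_dyadicLimit (h : IsDyadicPath T x) : Monotone (dyadicLimit x) := fun s _ hst =>
  le_ciInf fun m => (h.dyadicLimit_le m s).trans (h.mono m (dyadicIndex_mono m hst))

/-- Monotonicity gives left limits and the lower half of right-continuity. For the upper half, a
value at a grid point strictly after t bounds the path on a neighbourhood of t. -/
theorem isCadlag_dyadicLimit (h : IsDyadicPath T x) : IsCadlag (dyadicLimit x) := by
  refine ⟨fun t => ?_, fun t => ⟨_, h.monotone_dyadicLimit.tendsto_nhdsLT t⟩⟩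
  refine tendsto_order.2 ⟨fun a ha => ?_, fun b hb => ?_⟩
  · filter_upwards [self_mem_nhdsWithin] with u hu
    exact ha.trans_le (h.monotone_dyadicLimit hu)
  · obtain ⟨m, hm⟩ := exists_lt_of_ciInf_lt hb
    have hopen : IsOpen {u : ℝ≥0 | u * 2 ^ m < dyadicIndex m t} :=
      isOpen_lt (by fun_prop) continuous_const
    filter_upwards [mem_nhdsWithin_of_mem_nhds (hopen.mem_nhds (lt_dyadicIndex m t))] with u hu
    exact ((h.dyadicLimit_le m u).trans (h.mono m (dyadicIndex_le_of_lt hu))).trans_lt hm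

end IsDyadicPath

/-! ### Existence of cadlag Markov processes with nondecreasing paths -/

/-- A semigroup of Markov kernels on `ℝ` which move upwards, do not cross the level `T`, and depend
continuously on the time and on the starting point. -/
structure IsMonotoneSemigroup (T : ℝ) (κ : ℝ≥0 → Kernel ℝ ℝ) : Prop where
  isMarkovKernel : ∀ t, IsMarkovKernel (κ t)
  zero : ∀ a, κ 0 a = Measure.dirac a
  add : ∀ s t, κ (s + t) = κ t ∘ₖ κ s
  Iio : ∀ t a, κ t a (Iio a) = 0
  Ioi : ∀ t, ∀ a ≤ T, κ t a (Ioi T) = 0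
  tendsto : ∀ (f : ℝ →ᵇ ℝ) (t : ℕ → ℝ≥0) (a : ℕ → ℝ) (t₀ : ℝ≥0) (a₀ : ℝ),
    Tendsto t atTop (𝓝 t₀) → Tendsto a atTop (𝓝 a₀) → (∀ n, a n ∈ Icc a₀ T) →
      Tendsto (fun n => ∫ b, f b ∂κ (t n) (a n)) atTop (𝓝 (∫ b, f b ∂κ t₀ a₀))

/-- The transition kernels of the process with semigroup `κ` at the times `k / 2^m`. -/
def dyadicKernel (κ : ℝ≥0 → Kernel ℝ ℝ) (m i j : ℕ) : Kernel ℝ ℝ :=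
  κ (((j - i : ℕ) : ℝ≥0) / 2 ^ m)

/-- Each grid carries a chain, consecutive grids are consistent in law, and the inverse limit turns
this into consistency almost surely on one space. Monotonicity and the bound T concern countably
many coordinates. -/
theorem exists_dyadicPath_measure {T : ℝ} {κ : ℝ≥0 → Kernel ℝ ℝ} (hκ : IsMonotoneSemigroup T κ)
    (μ : Measure ℝ) [IsProbabilityMeasure μ] (hμ : μ (Ioi T) = 0) :
    ∃ R : Measure (ℕ → ℕ → ℝ), IsProbabilityMeasure R ∧ (∀ᵐ x ∂ R, IsDyadicPath T x) ∧
      ∀ m, (R.map fun x => x m).map (fun y => y 0) = μ ∧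
        IsMarkovLaw (fun k (y : ℕ → ℝ) => y k) (dyadicKernel κ m) (R.map fun x => x m) := by
  have hκm := hκ.isMarkovKernel
  have hcoord : ∀ k, Measurable fun y : ℕ → ℝ => y k := fun k => measurable_pi_apply k
  have hexQ : ∀ m, ∃ Q : Measure (ℕ → ℝ), IsProbabilityMeasure Q ∧ Q.map (fun y => y 0) = μ ∧
      IsMarkovLaw (fun k (y : ℕ → ℝ) => y k) (dyadicKernel κ m) Q := by
    intro m
    obtain ⟨Q, hQ, hQ0, hQs⟩ := exists_markovChain (fun _ => κ (1 / 2 ^ m)) μ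
    refine ⟨Q, hQ, hQ0, isMarkovLaw_of_succ hcoord ?_ ?_ ?_⟩
    · intro n a
      simp [dyadicKernel, hκ.zero]
    · intro i n hin
      rw [dyadicKernel, dyadicKernel, dyadicKernel, ← hκ.add, ← add_div, ← Nat.cast_add]
      congr 4
      omega
    · intro n A hA B hB
      simpa [dyadicKernel] using hQs n A hA B hB
  choose Q hQ hQ0 hQM using hexQ
  let θ : (ℕ → ℝ) → (ℕ → ℝ) := fun y k => y (2 * k)
  have hθ : Measurable θ := measurable_pi_lambda _ fun k => measurable_pi_apply _
  have hQθ : ∀ m, (Q (m + 1)).map θ = Q m := by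
    intro m
    -- The even-indexed subsequence of the finer chain is Markov with the kernels of the coarser
    -- one, so uniqueness of Markov laws identifies the two.
    have h := IsMarkovLaw.map_eq (X := fun k (y : ℕ → ℝ) => y (2 * k))
      (X' := fun k (y : ℕ → ℝ) => y k) (K := dyadicKernel κ m) (P := Q (m + 1)) (P' := Q m)
      (fun k => measurable_pi_apply _) hcoord ?_ (hQM m) ?_
    · rw [show (fun (y : ℕ → ℝ) i => y i) = id from rfl, Measure.map_id] at h
      exact h
    · intro i j hij A hA B hB
      have hle : pastSigma (fun k (y : ℕ → ℝ) => y (2 * k)) i ≤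
          pastSigma (fun k (y : ℕ → ℝ) => y k) (2 * i) :=
        iSup₂_le fun l hl => measurable_iff_comap_le.1
          (measurable_pastSigma (fun k (y : ℕ → ℝ) => y k) (Nat.mul_le_mul_left 2 hl))
      have hK : dyadicKernel κ m i j = dyadicKernel κ (m + 1) (2 * i) (2 * j) := by
        rw [dyadicKernel, dyadicKernel, ← Nat.mul_sub]
        congr 1
        push_cast
        rw [pow_succ']
        field_simp
      rw [hK]
      exact hQM (m + 1) (2 * i) (2 * j) (by omega) A (hle A hA) B hB
    · simpa using (hQ0 (m + 1)).trans (hQ0 m).symm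
  obtain ⟨R, hR, hRQ, hRθ⟩ := exists_inverseLimit hθ Q hQθ
  refine ⟨R, hR, ?_, fun m => ?_⟩
  · have hle : ∀ m k, ∀ᵐ x ∂ R, x m k ≤ x m (k + 1) := fun m k => by
      have h := (hQM m).ae_le hcoord (Nat.le_succ k) fun a => hκ.Iio _ a
      rw [← hRQ m] at h
      exact ae_of_ae_map (measurable_pi_apply m).aemeasurable h
    have hT : ∀ m k, ∀ᵐ x ∂ R, x m k ≤ T := fun m k => by
      have h0 : ∀ᵐ y ∂Q m, y 0 ≤ T := by
        have : ∀ᵐ b ∂(Q m).map (fun y => y 0), b ≤ T := by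
          rw [hQ0 m]
          filter_upwards [measure_eq_zero_iff_ae_notMem.1 hμ] with b hb
          exact not_lt.1 hb
        exact ae_of_ae_map (hcoord 0).aemeasurable this
      have h := (hQM m).ae_le_const (Nat.zero_le k) (fun a ha => hκ.Ioi _ a ha) h0
      rw [← hRQ m] at h
      exact ae_of_ae_map (measurable_pi_apply m).aemeasurable h
    filter_upwards [ae_all_iff.2 hRθ, ae_all_iff.2 fun m => ae_all_iff.2 (hle m),
      ae_all_iff.2 fun m => ae_all_iff.2 (hT m)] with x h1 h2 h3
    exact ⟨fun m k => congrFun (h1 m) k, h2, h3⟩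
  · rw [hRQ m]
    exact ⟨hQ0 m, hQM m⟩

theorem IsMarkovLaw.integral_mul {ι Ω E β : Type*} [MeasurableSpace E] [Preorder ι]
    [MeasurableSpace Ω] [MeasurableSpace β] {X : ι → Ω → E} {K : ι → ι → Kernel E E}
    [∀ s t, IsMarkovKernel (K s t)] {P : Measure Ω} [IsFiniteMeasure P] (h : IsMarkovLaw X K P)
    (hX : ∀ i, Measurable (X i)) {s t : ι} (hst : s ≤ t) {Z : Ω → β}
    (hZ : @Measurable _ _ (pastSigma X s) _ Z) {z : β → E} (hz : Measurable z)
    (hzZ : ∀ ω, z (Z ω) = X s ω) {F : β → ℝ} {f : E → ℝ} (hF : Measurable F) (hf : Measurable f)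
    {C D : ℝ} (hFC : ∀ x, ‖F x‖ ≤ C) (hfD : ∀ x, ‖f x‖ ≤ D) :
    ∫ ω, F (Z ω) * f (X t ω) ∂P = ∫ ω, F (Z ω) * (∫ b, f b ∂K s t (X s ω)) ∂P := by
  have hZ' : Measurable Z := hZ.mono (pastSigma_le hX s) le_rfl
  have hFm : Measurable fun p : β × E => F p.1 * f p.2 :=
    (hF.comp measurable_fst).mul (hf.comp measurable_snd)
  have hint : ∀ ρ : Measure (β × E), IsFiniteMeasure ρ →
      Integrable (fun p : β × E => F p.1 * f p.2) ρ := fun ρ _ => by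
    refine Integrable.of_bound hFm.aestronglyMeasurable (C * D) (.of_forall fun p => ?_)
    rw [norm_mul]
    exact mul_le_mul (hFC _) (hfD _) (norm_nonneg _) ((norm_nonneg _).trans (hFC p.1))
  have h2 : ∫ p, F p.1 * f p.2 ∂(P.map fun ω => (Z ω, X t ω)) = ∫ ω, F (Z ω) * f (X t ω) ∂P :=
    integral_map (hZ'.prodMk (hX t)).aemeasurable hFm.aestronglyMeasurable
  rw [← h2, h.map_prod_eq hX hst hZ hz hzZ, Measure.integral_compProd (hint _ inferInstance),
    integral_map hZ'.aemeasurable]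
  · refine integral_congr_ae (.of_forall fun ω => ?_)
    simp only [integral_const_mul, Kernel.comap_apply, hzZ]
  · exact (StronglyMeasurable.integral_kernel_prod_right' hFm.stronglyMeasurable).aestronglyMeasurable

theorem measurableSet_isDyadicPath (T : ℝ) : MeasurableSet {x : ℕ → ℕ → ℝ | IsDyadicPath T x} := by
  have hc : ∀ m k, Measurable fun x : ℕ → ℕ → ℝ => x m k := fun m k =>
    (measurable_pi_apply k).comp (measurable_pi_apply m)
  have h : {x : ℕ → ℕ → ℝ | IsDyadicPath T x} = (⋂ m, ⋂ k, {x | x (m + 1) (2 * k) = x m k}) ∩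
      ((⋂ m, ⋂ k, {x | x m k ≤ x m (k + 1)}) ∩ ⋂ m, ⋂ k, {x | x m k ≤ T}) := by
    ext x
    simp only [mem_ofPred_eq, mem_inter_iff, mem_iInter]
    exact ⟨fun h => ⟨h.1, h.2, h.3⟩, fun h => ⟨h.1, h.2.1, h.2.2⟩⟩
  rw [h]
  refine (MeasurableSet.iInter fun m => .iInter fun k => ?_).inter
    ((MeasurableSet.iInter fun m => .iInter fun k => ?_).inter
      (MeasurableSet.iInter fun m => .iInter fun k => ?_))
  · exact measurableSet_eq_fun (hc _ _) (hc _ _)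
  · exact measurableSet_le (hc _ _) (hc _ _)
  · exact measurableSet_le (hc _ _) measurable_const

open Classical in
/-- The cadlag path with given values at dyadic times (and the zero path for inadmissible values). -/
def dyadicCadlag (T : ℝ) (x : ℕ → ℕ → ℝ) : CadlagPath :=
  if h : IsDyadicPath T x then ⟨dyadicLimit x, h.isCadlag_dyadicLimit⟩
  else ⟨fun _ => 0, fun _ => continuousWithinAt_const, fun _ => ⟨0, tendsto_const_nhds⟩⟩

theorem pathCoord_dyadicCadlag {T : ℝ} {x : ℕ → ℕ → ℝ} (h : IsDyadicPath T x) (t : ℝ≥0) :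
    pathCoord t (dyadicCadlag T x) = dyadicLimit x t := by
  rw [dyadicCadlag, dif_pos h]
  rfl

theorem measurable_dyadicCadlag (T : ℝ) : Measurable (dyadicCadlag T) := by
  classical
  refine Measurable.subtype_mk (f := fun x => (dyadicCadlag T x).1)
    (measurable_pi_lambda _ fun t => ?_)
  have h : (fun x => (dyadicCadlag T x).1 t) =
      fun x => if IsDyadicPath T x then dyadicLimit x t else 0 := by
    funext x
    unfold dyadicCadlag
    split_ifs <;> rfl
  rw [h]
  refine Measurable.ite (measurableSet_isDyadicPath T) ?_ measurable_const
  exact Measurable.iInf fun m => (measurable_pi_apply _).comp (measurable_pi_apply m)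

/-- The path law is the image of the dyadic law under right limits. The discrete Markov identities,
tested on bounded continuous functions of finitely many grid values, converge by domination and the
continuity of the semigroup. -/
theorem exists_cadlag_of_isMonotoneSemigroup {T : ℝ} {κ : ℝ≥0 → Kernel ℝ ℝ}
    (hκ : IsMonotoneSemigroup T κ) (μ : Measure ℝ) [IsProbabilityMeasure μ] (hμ : μ (Ioi T) = 0) :
    ∃ P : Measure CadlagPath, IsProbabilityMeasure P ∧ P.map (pathCoord 0) = μ ∧
      IsMarkovLaw pathCoord (fun s t => κ (t - s)) P := by
  have hκm := hκ.isMarkovKernel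
  obtain ⟨R, hR, hpath, hRm⟩ := exists_dyadicPath_measure hκ μ hμ
  have hc : ∀ m k, Measurable fun x : ℕ → ℕ → ℝ => x m k := fun m k =>
    (measurable_pi_apply k).comp (measurable_pi_apply m)
  have hev : ∀ m, Measurable fun x : ℕ → ℕ → ℝ => x m := fun m => measurable_pi_apply m
  have hcoord : ∀ k, Measurable fun y : ℕ → ℝ => y k := fun k => measurable_pi_apply k
  have hD := measurable_dyadicCadlag T
  have hK : ∀ m i j, IsMarkovKernel (dyadicKernel κ m i j) := fun m i j => hκm _
  have hQ : ∀ m, IsProbabilityMeasure (R.map fun x => x m) := fun m =>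
    Measure.isProbabilityMeasure_map (hev m).aemeasurable
  -- the discrete Markov property, for observables which depend on finitely many times
  have hdisc : ∀ (I : Finset ℝ≥0) (s : ℝ≥0), s ∈ I → (∀ j ∈ I, j ≤ s) → ∀ (m k : ℕ),
      dyadicIndex m s ≤ k → ∀ (F : (I → ℝ) →ᵇ ℝ) (f : ℝ →ᵇ ℝ),
      ∫ x, F (fun j => x m (dyadicIndex m j)) * f (x m k) ∂ R =
        ∫ x, F (fun j => x m (dyadicIndex m j)) *
          (∫ b, f b ∂κ (((k - dyadicIndex m s : ℕ) : ℝ≥0) / 2 ^ m) (x m (dyadicIndex m s))) ∂ R := by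
    intro I s hs hI m k hk F f
    let Z : (ℕ → ℝ) → (I → ℝ) := fun y j => y (dyadicIndex m j)
    have hZp : @Measurable _ _ (pastSigma (fun k (y : ℕ → ℝ) => y k) (dyadicIndex m s)) _ Z :=
      (@measurable_pi_iff _ _ _ (pastSigma _ _) _ _).2 fun j =>
        measurable_pastSigma (fun k (y : ℕ → ℝ) => y k) (dyadicIndex_mono m (hI j j.2))
    have hZ : Measurable Z := measurable_pi_lambda _ fun j => measurable_pi_apply _
    have hF := F.continuous.measurable.comp hZ
    have hf := f.continuous.measurable
    have h1 := (hRm m).2.integral_mul hcoord hk hZp (z := fun x : I → ℝ => x ⟨s, hs⟩)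
      (measurable_pi_apply _) (fun _ => rfl) F.continuous.measurable hf F.norm_coe_le_norm
      f.norm_coe_le_norm
    rw [integral_map (hev m).aemeasurable, integral_map (hev m).aemeasurable] at h1
    · exact h1
    · exact (hF.mul ((hf.stronglyMeasurable.integral_kernel).measurable.comp
        (hcoord _))).aestronglyMeasurable
    · exact (hF.mul (hf.comp (hcoord k))).aestronglyMeasurable
  refine ⟨R.map (dyadicCadlag T), Measure.isProbabilityMeasure_map hD.aemeasurable, ?_, ?_⟩
  · have h0 : Measurable (pathCoord 0 ∘ dyadicCadlag T) :=
      (measurable_pathCoord 0).comp hD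
    rw [Measure.map_map (measurable_pathCoord 0) hD]
    have hP0 : IsProbabilityMeasure (R.map (pathCoord 0 ∘ dyadicCadlag T)) :=
      Measure.isProbabilityMeasure_map h0.aemeasurable
    refine ext_of_forall_integral_eq_of_IsFiniteMeasure fun f => ?_
    have hf := f.continuous.measurable
    rw [integral_map h0.aemeasurable hf.aestronglyMeasurable]
    -- Right limits at time 0 use the grid time 2^(-m), not 0, so the initial law is recovered only
    -- as the limit of μ moved by a short time.
    have hidx : ∀ m, dyadicIndex m 0 = 1 := fun m => by simp [dyadicIndex]
    have hlim : Tendsto (fun m => ∫ x, f (x m 1) ∂ R) atTop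
        (𝓝 (∫ x, f (pathCoord 0 (dyadicCadlag T x)) ∂ R)) := by
      refine tendsto_integral_of_dominated_convergence (fun _ => ‖f‖)
        (fun m => (hf.comp (hc m 1)).aestronglyMeasurable) (integrable_const _)
        (fun m => .of_forall fun x => f.norm_coe_le_norm _) ?_
      filter_upwards [hpath] with x hx
      rw [pathCoord_dyadicCadlag hx]
      have := (f.continuous.tendsto _).comp (hx.tendsto_dyadicLimit 0)
      simpa only [Function.comp_def, hidx] using this
    have hlim2 : Tendsto (fun m : ℕ => ∫ a, (∫ b, f b ∂κ (1 / 2 ^ m) a) ∂μ) atTop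
        (𝓝 (∫ a, f a ∂μ)) := by
      refine tendsto_integral_of_dominated_convergence (fun _ => ‖f‖)
        (fun m => hf.stronglyMeasurable.integral_kernel.aestronglyMeasurable) (integrable_const _)
        (fun m => .of_forall fun a => f.norm_integral_le_norm _) ?_
      filter_upwards [measure_eq_zero_iff_ae_notMem.1 hμ] with a ha
      have h2 : Tendsto (fun m : ℕ => (1 : ℝ≥0) / 2 ^ m) atTop (𝓝 0) := by
        simpa using tendsto_pow_atTop_nhds_zero_of_lt_one (r := (1 / 2 : ℝ≥0))
          zero_le (by rw [← NNReal.coe_lt_coe]; norm_num)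
      have := hκ.tendsto f _ (fun _ => a) 0 a h2 tendsto_const_nhds
        fun _ => ⟨le_rfl, not_lt.1 ha⟩
      simpa [hκ.zero] using this
    refine tendsto_nhds_unique hlim (hlim2.congr fun m => ?_)
    have h1 := (hRm m).2.integral_mul hcoord zero_le_one
      (measurable_pastSigma (fun k (y : ℕ → ℝ) => y k) (le_refl 0)) measurable_id
      (fun _ => rfl) (F := fun _ => 1) (C := 1) measurable_const hf (by simp) f.norm_coe_le_norm
    have hfm : AEStronglyMeasurable (fun y : ℕ → ℝ => f (y 1)) (R.map fun x => x m) :=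
      (hf.comp (hcoord 1)).aestronglyMeasurable
    simp only [one_mul] at h1
    rw [integral_map (hev m).aemeasurable hfm] at h1
    rw [h1, ← (hRm m).1, integral_map (hcoord 0).aemeasurable
      hf.stronglyMeasurable.integral_kernel.aestronglyMeasurable]
    simp [dyadicKernel]
  have hP : IsProbabilityMeasure (R.map (dyadicCadlag T)) :=
    Measure.isProbabilityMeasure_map hD.aemeasurable
  refine isMarkovLaw_of_finset measurable_pathCoord fun s u hsu I hs hI => ?_
  obtain ⟨t, rfl⟩ : ∃ t, u = s + t := ⟨u - s, (add_tsub_cancel_of_le hsu).symm⟩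
  have hXI : Measurable fun (ω : CadlagPath) (j : I) => pathCoord j ω :=
    measurable_pi_lambda _ fun j => measurable_pathCoord j
  have hpair : Measurable fun (ω : CadlagPath) => ((fun j : I => pathCoord j ω), pathCoord (s + t) ω) :=
    hXI.prodMk (measurable_pathCoord _)
  have hP1 : IsProbabilityMeasure ((R.map (dyadicCadlag T)).map fun ω =>
      ((fun j : I => pathCoord j ω), pathCoord (s + t) ω)) :=
    Measure.isProbabilityMeasure_map hpair.aemeasurable
  have hP2 : IsProbabilityMeasure ((R.map (dyadicCadlag T)).map fun ω (j : I) => pathCoord j ω) :=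
    Measure.isProbabilityMeasure_map hXI.aemeasurable
  refine Measure.ext_of_integral_mul_boundedContinuousFunction fun F f => ?_
  have hf := f.continuous.measurable
  have hFm : Measurable fun p : (I → ℝ) × ℝ => F p.1 * f p.2 :=
    (F.continuous.measurable.comp measurable_fst).mul (hf.comp measurable_snd)
  have hbound : ∀ (x : I → ℝ) (b : ℝ), ‖F x * b‖ ≤ ‖F‖ * ‖b‖ := fun x b => by
    rw [norm_mul]
    gcongr
    exact F.norm_coe_le_norm x
  have hint : ∀ ρ : Measure ((I → ℝ) × ℝ), IsFiniteMeasure ρ →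
      Integrable (fun p : (I → ℝ) × ℝ => F p.1 * f p.2) ρ := fun ρ _ =>
    Integrable.of_bound hFm.aestronglyMeasurable (‖F‖ * ‖f‖) (.of_forall fun p =>
      (hbound _ _).trans (by gcongr; exact f.norm_coe_le_norm _))
  have hZ : ∀ m, Measurable fun (x : ℕ → ℕ → ℝ) (j : I) => x m (dyadicIndex m j) := fun m =>
    measurable_pi_lambda _ fun j => hc m _
  have hker : ∀ t : ℝ≥0, Measurable fun a => ∫ b, f b ∂κ t a := fun t =>
    hf.stronglyMeasurable.integral_kernel.measurable
  rw [Measure.integral_compProd (hint _ inferInstance), integral_map hpair.aemeasurable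
      hFm.aestronglyMeasurable, integral_map hXI.aemeasurable
      (StronglyMeasurable.integral_kernel_prod_right' hFm.stronglyMeasurable).aestronglyMeasurable]
  simp only [integral_const_mul, Kernel.comap_apply, add_tsub_cancel_left]
  have hm1 : Measurable fun ω : CadlagPath =>
      F (fun j : I => pathCoord j ω) * f (pathCoord (s + t) ω) := hFm.comp hpair
  have hm2 : Measurable fun ω : CadlagPath =>
      F (fun j : I => pathCoord j ω) * (∫ b, f b ∂κ t (pathCoord s ω)) :=
    (F.continuous.measurable.comp hXI).mul ((hker t).comp (measurable_pathCoord s))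
  rw [integral_map hD.aemeasurable hm1.aestronglyMeasurable,
    integral_map hD.aemeasurable hm2.aestronglyMeasurable]
  have hlimZ : ∀ x, IsDyadicPath T x → Tendsto (fun m => F fun j : I => x m (dyadicIndex m j)) atTop
      (𝓝 (F fun j : I => pathCoord j (dyadicCadlag T x))) := fun x hx => by
    refine (F.continuous.tendsto _).comp (tendsto_pi_nhds.2 fun j => ?_)
    rw [pathCoord_dyadicCadlag hx]
    exact hx.tendsto_dyadicLimit j
  have hlim1 : Tendsto (fun m => ∫ x, F (fun j : I => x m (dyadicIndex m j)) *
      f (x m (dyadicIndex m (s + t))) ∂ R) atTop (𝓝 (∫ x, F (fun j : I =>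
        pathCoord j (dyadicCadlag T x)) * f (pathCoord (s + t) (dyadicCadlag T x)) ∂ R)) := by
    refine tendsto_integral_of_dominated_convergence (fun _ => ‖F‖ * ‖f‖)
      (fun m => ((F.continuous.measurable.comp (hZ m)).mul (hf.comp (hc m _))).aestronglyMeasurable)
      (integrable_const _) (fun m => .of_forall fun x =>
        (hbound _ _).trans (by gcongr; exact f.norm_coe_le_norm _)) ?_
    filter_upwards [hpath] with x hx
    refine (hlimZ x hx).mul ?_
    rw [pathCoord_dyadicCadlag hx]
    exact (f.continuous.tendsto _).comp (hx.tendsto_dyadicLimit (s + t))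
  have hlim2 : Tendsto (fun m => ∫ x, F (fun j : I => x m (dyadicIndex m j)) *
      (∫ b, f b ∂κ (((dyadicIndex m (s + t) - dyadicIndex m s : ℕ) : ℝ≥0) / 2 ^ m)
        (x m (dyadicIndex m s))) ∂ R) atTop (𝓝 (∫ x, F (fun j : I =>
        pathCoord j (dyadicCadlag T x)) *
          (∫ b, f b ∂κ t (pathCoord s (dyadicCadlag T x))) ∂ R)) := by
    refine tendsto_integral_of_dominated_convergence (fun _ => ‖F‖ * ‖f‖)
      (fun m => ((F.continuous.measurable.comp (hZ m)).mul
        ((hker _).comp (hc m _))).aestronglyMeasurable)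
      (integrable_const _) (fun m => .of_forall fun x =>
        (hbound _ _).trans (by gcongr; exact f.norm_integral_le_norm _)) ?_
    filter_upwards [hpath] with x hx
    refine (hlimZ x hx).mul ?_
    rw [pathCoord_dyadicCadlag hx]
    -- The grid values decrease to the state at s, which is the one-sided convergence allowed by
    -- `IsMonotoneSemigroup.tendsto`.
    exact hκ.tendsto f _ _ t _ tendsto_dyadicIndex_sub_div (hx.tendsto_dyadicLimit s)
      fun m => ⟨hx.dyadicLimit_le m s, hx.le_const _ _⟩
  exact tendsto_nhds_unique hlim1 (hlim2.congr fun m =>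
    (hdisc I s hs hI m _ (dyadicIndex_mono m (le_add_of_nonneg_right zero_le)) F f).symm)

/-! ### Existence and uniqueness of the Volterra path law -/

/-- The defining property of conditional expectation, in both directions, moved from real-valued to
`ℝ≥0∞`-valued integrals; boundedness by one makes all of them finite. -/
theorem condProb_ae_eq_toReal_iff {Ω : Type*} {m m₀ : MeasurableSpace Ω} (hm : m ≤ m₀)
    {P : Measure Ω} [IsProbabilityMeasure P] {S : Set Ω} (hS : MeasurableSet S) {g : Ω → ℝ≥0∞}
    (hg : Measurable[m] g) (hg1 : ∀ ω, g ω ≤ 1) :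
    (P⟦S | m⟧ =ᵐ[P] fun ω => (g ω).toReal) ↔
      ∀ A, MeasurableSet[m] A → P (A ∩ S) = ∫⁻ ω in A, g ω ∂P := by
  have hgm : Measurable g := hg.mono hm le_rfl
  have hgt : ∀ ω, g ω ≠ ∞ := fun ω => ((hg1 ω).trans_lt ENNReal.one_lt_top).ne
  have hint : Integrable (S.indicator fun _ => (1 : ℝ)) P := (integrable_const 1).indicator hS
  have hgint : Integrable (fun ω => (g ω).toReal) P :=
    Integrable.of_bound hgm.ennreal_toReal.aestronglyMeasurable 1 (.of_forall fun ω => by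
      rw [Real.norm_of_nonneg ENNReal.toReal_nonneg]
      exact ENNReal.toReal_mono ENNReal.one_ne_top (hg1 ω))
  have hl : ∀ A, MeasurableSet[m] A →
      ∫ ω in A, S.indicator (fun _ => (1 : ℝ)) ω ∂P = (P (A ∩ S)).toReal := fun A hA => by
    rw [integral_indicator_const _ hS, measureReal_def, Measure.restrict_apply hS, inter_comm,
      smul_eq_mul, mul_one]
  have hr : ∀ A, ∫ ω in A, (g ω).toReal ∂P = (∫⁻ ω in A, g ω ∂P).toReal := fun A =>
    integral_toReal hgm.aemeasurable (.of_forall fun ω => (hgt ω).lt_top)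
  have hfin : ∀ A, ∫⁻ ω in A, g ω ∂P ≠ ∞ := fun A =>
    ((lintegral_mono fun ω => hg1 ω).trans_lt (by simp)).ne
  constructor
  · intro h A hA
    have h1 := setIntegral_condExp hm hint hA
    rw [setIntegral_congr_ae (hm A hA) (h.mono fun ω hω _ => hω), hr A, hl A hA] at h1
    exact ((ENNReal.toReal_eq_toReal_iff' (hfin A) (measure_ne_top _ _)).1 h1).symm
  · intro h
    refine (ae_eq_condExp_of_forall_setIntegral_eq hm hint (fun _ _ _ => hgint.integrableOn)
      (fun A hA _ => ?_) hg.ennreal_toReal.aestronglyMeasurable).symm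
    rw [hr A, hl A hA, h A hA]

theorem isVolterraPathLaw_iff {T lam : ℝ} (hlam : 0 < lam) {ϑ : Measure (Icc (0 : ℝ) T)}
    {P : Measure CadlagPath} :
    IsVolterraPathLaw T lam ϑ P ↔ IsProbabilityMeasure P ∧
      P.map (pathCoord 0) = ϑ.map Subtype.val ∧
      IsMarkovLaw pathCoord (fun s t => volterraKer T hlam (t - s)) P := by
  have key : ∀ [IsProbabilityMeasure P] (s t : ℝ≥0) (B : Set ℝ), MeasurableSet B →
      ((P⟦pathCoord (s + t) ⁻¹' B | coordFiltration s⟧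
        =ᵐ[P] fun ω => (volterraKernel T lam t (pathCoord s ω)).real B) ↔
      ∀ A, MeasurableSet[pastSigma pathCoord s] A → P (A ∩ pathCoord (s + t) ⁻¹' B) =
        ∫⁻ ω in A, volterraKer T hlam t (pathCoord s ω) B ∂P) := by
    intro _ s t B hB
    exact condProb_ae_eq_toReal_iff (coordFiltration.le s) (measurable_pathCoord _ hB)
      (((volterraKer T hlam t).measurable_coe hB).comp (measurable_pastSigma pathCoord le_rfl))
      fun ω => prob_le_one (μ := volterraKer T hlam t (pathCoord s ω))
  constructor
  · intro h
    have := h.isProbabilityMeasure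
    refine ⟨this, h.initial, fun s u hsu A hA B hB => ?_⟩
    obtain ⟨t, rfl⟩ : ∃ t, u = s + t := ⟨u - s, (add_tsub_cancel_of_le hsu).symm⟩
    simp only [add_tsub_cancel_left]
    exact (key s t B hB).1 (h.markov s t B hB) A hA
  · rintro ⟨hP, h0, hM⟩
    refine ⟨hP, h0, fun s t B hB => (key s t B hB).2 fun A hA => ?_⟩
    have := hM s (s + t) (le_add_of_nonneg_right zero_le) A hA B hB
    simpa only [add_tsub_cancel_left] using this

theorem isMonotoneSemigroup_volterraKer (T : ℝ) {lam : ℝ} (hlam : 0 < lam) :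
    IsMonotoneSemigroup T (volterraKer T hlam) where
  isMarkovKernel := fun _ => inferInstance
  zero := volterraKer_zero T hlam
  add := volterraKer_add T hlam
  Iio := volterraKer_Iio T hlam
  Ioi := fun t _ ha => volterraKer_Ioi T hlam t ha
  tendsto := fun f _ _ _ _ ht ha h => tendsto_integral_volterraKer hlam f ht ha h

/-- The σ-algebra on paths is pulled back from the product, so every measurable set is a preimage
under the coordinate map. -/
theorem cadlagPath_measure_ext {P P' : Measure CadlagPath}
    (h : P.map (fun ω (i : ℝ≥0) => pathCoord i ω) = P'.map (fun ω (i : ℝ≥0) => pathCoord i ω)) :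
    P = P' := by
  ext A hA
  obtain ⟨S, hS, rfl⟩ := hA
  have hm : Measurable fun (ω : CadlagPath) (i : ℝ≥0) => pathCoord i ω := measurable_subtype_coe
  have h1 := congrArg (fun ρ => ρ S) h
  rw [Measure.map_apply hm hS, Measure.map_apply hm hS] at h1
  exact h1

theorem existsUnique_isVolterraPathLaw (T : ℝ) {lam : ℝ} (hlam : 0 < lam)
    (ϑ : Measure (Icc (0 : ℝ) T)) [IsProbabilityMeasure ϑ] :
    ∃! P : Measure CadlagPath, IsVolterraPathLaw T lam ϑ P := by
  have hϑ : IsProbabilityMeasure (ϑ.map Subtype.val) :=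
    Measure.isProbabilityMeasure_map measurable_subtype_coe.aemeasurable
  have hϑT : ϑ.map Subtype.val (Ioi T) = 0 := by
    rw [Measure.map_apply measurable_subtype_coe measurableSet_Ioi]
    convert! measure_empty (μ := ϑ)
    ext a
    simpa using a.2.2
  obtain ⟨P, hP, hP0, hPM⟩ := exists_cadlag_of_isMonotoneSemigroup
    (isMonotoneSemigroup_volterraKer T hlam) (ϑ.map Subtype.val) hϑT
  refine ⟨P, (isVolterraPathLaw_iff hlam).2 ⟨hP, hP0, hPM⟩, fun P' hP' => ?_⟩
  obtain ⟨hP', hP0', hPM'⟩ := (isVolterraPathLaw_iff hlam).1 hP'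
  exact cadlagPath_measure_ext (hPM'.map_eq measurable_pathCoord measurable_pathCoord hPM
    (hP0'.trans hP0.symm))

/-! ### The absorption time -/

theorem exists_dense_mem_Ioo_of_eventually {D : Set ℝ≥0} (hD : Dense D) {t u : ℝ≥0} (htu : t < u)
    {p : ℝ≥0 → Prop} (hp : ∀ᶠ v in 𝓝[≥] t, p v) : ∃ d ∈ D, t < d ∧ d < u ∧ p d := by
  obtain ⟨v, hv, hvp⟩ := mem_nhdsGE_iff_exists_Ico_subset.1 hp
  obtain ⟨d, hdD, hd1, hd2⟩ := hD.exists_between (lt_min htu hv)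
  exact ⟨d, hdD, hd1, hd2.trans_le (min_le_left _ _), hvp ⟨hd1.le, hd2.trans_le (min_le_right _ _)⟩⟩

theorem monotone_of_monotoneOn_dense {D : Set ℝ≥0} (hD : Dense D) {ω : ℝ≥0 → ℝ}
    (hω : ∀ t, ContinuousWithinAt ω (Ici t) t) (h : ∀ d ∈ D, ∀ e ∈ D, d ≤ e → ω d ≤ ω e) :
    Monotone ω := by
  intro s t hst
  rcases hst.eq_or_lt with rfl | hlt
  · exact le_rfl
  by_contra hc
  obtain ⟨c, hc1, hc2⟩ := exists_between (not_le.1 hc)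
  obtain ⟨d, hdD, -, hdt, hd⟩ := exists_dense_mem_Ioo_of_eventually hD hlt
    ((tendsto_order.1 (hω s)).1 c hc2)
  obtain ⟨e, heD, hte, -, he⟩ := exists_dense_mem_Ioo_of_eventually hD (lt_add_one t)
    ((tendsto_order.1 (hω t)).2 c hc1)
  linarith [h d hdD e heD (hdt.trans hte).le]

/-- A monotone path bounded by T stays at T once it is there, and right-continuity makes the infimum
attained. -/
theorem absorptionTime_le_iff {T : ℝ} {ω : CadlagPath} (hm : Monotone ω.1) (hT : ∀ t, ω.1 t ≤ T)
    (v : ℝ≥0) : absorptionTime T ω ≤ v ↔ pathCoord v ω = T := by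
  constructor
  · intro h
    have hgt : ∀ u > v, ω.1 u = T := by
      intro u hu
      have h1 : absorptionTime T ω < u := h.trans_lt (by exact_mod_cast hu)
      simp only [absorptionTime, iInf_lt_iff] at h1
      obtain ⟨s, hs, hsu⟩ := h1
      exact le_antisymm (hT u) (hs.symm.le.trans (hm (by exact_mod_cast hsu.le)))
    have h2 : Tendsto ω.1 (𝓝[>] v) (𝓝 (ω.1 v)) := (ω.2.1 v).mono Ioi_subset_Ici_self
    have h3 : Tendsto ω.1 (𝓝[>] v) (𝓝 T) :=
      tendsto_const_nhds.congr' (by filter_upwards [self_mem_nhdsWithin] with u hu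
                                    exact (hgt u hu).symm)
    exact tendsto_nhds_unique h2 h3
  · intro h
    exact iInf₂_le v h

/-- An infimum over all times need not be measurable. On monotone paths bounded by T a countable
dense set of times gives the same infimum, because the hitting set is closed upwards. -/
theorem exists_measurable_eq_absorptionTime (T : ℝ) : ∃ τ : CadlagPath → ℝ≥0∞, Measurable τ ∧
    ∀ ω : CadlagPath, Monotone ω.1 → (∀ t, ω.1 t ≤ T) → absorptionTime T ω = τ ω := by
  classical
  obtain ⟨D, hDc, hD⟩ := TopologicalSpace.exists_countable_dense ℝ≥0
  refine ⟨fun ω => ⨅ d ∈ D, if pathCoord d ω = T then (d : ℝ≥0∞) else ∞,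
    Measurable.biInf _ hDc fun d _ => ?_, fun ω hm hT => le_antisymm ?_ ?_⟩
  · exact Measurable.ite (measurable_pathCoord d (measurableSet_singleton T)) measurable_const
      measurable_const
  · refine le_iInf₂ fun d _ => ?_
    split_ifs with h
    · exact iInf₂_le d h
    · exact le_top
  · refine le_of_forall_gt fun c hc => ?_
    simp only [absorptionTime, iInf_lt_iff] at hc
    obtain ⟨s, hs, hsc⟩ := hc
    obtain ⟨r, hsr, hrc⟩ := ENNReal.lt_iff_exists_nnreal_btwn.1 hsc
    obtain ⟨d, hdD, hd1, hd2⟩ := hD.exists_between (ENNReal.coe_lt_coe.1 hsr)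
    have hdT : pathCoord d ω = T := le_antisymm (hT d) (hs.symm.le.trans (hm hd1.le))
    refine (iInf₂_le d hdD).trans_lt ?_
    rw [if_pos hdT]
    exact (ENNReal.coe_lt_coe.2 hd2).trans hrc

/-- The law of the absorption time of the Volterra process started at `a`. -/
def absorptionLaw (T lam a : ℝ) : Measure ℝ :=
  if a < T then (volume.restrict (Ioi 0)).withDensity
    fun r => (volterraMass lam (T - a))⁻¹ * absorptionWeight lam (T - a) r
  else Measure.dirac 0

theorem lintegral_absorptionLaw {T lam a : ℝ} (ha : a < T) {g : ℝ → ℝ≥0∞} (hg : Measurable g) :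
    ∫⁻ r, g r ∂absorptionLaw T lam a = (volterraMass lam (T - a))⁻¹ *
      ∫⁻ r in Ioi 0, absorptionWeight lam (T - a) r * g r := by
  rw [absorptionLaw, if_pos ha, lintegral_withDensity_eq_lintegral_mul _ (by fun_prop) hg,
    ← lintegral_const_mul _ (by fun_prop)]
  simp only [Pi.mul_apply, mul_assoc]

/-- `absorptionLaw`, as a kernel. -/
def absorptionKer (T lam : ℝ) : Kernel ℝ ℝ where
  toFun := absorptionLaw T lam
  measurable' := by
    refine Measure.measurable_of_measurable_coe _ fun B hB => ?_
    have h1 : Measurable (B.indicator (1 : ℝ → ℝ≥0∞)) := measurable_one.indicator hB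
    have h : (fun a => absorptionLaw T lam a B) = fun a => if a < T then
        (volterraMass lam (T - a))⁻¹ *
          ∫⁻ r in Ioi 0, absorptionWeight lam (T - a) r * B.indicator 1 r
        else Measure.dirac 0 B := by
      funext a
      split_ifs with ha
      · rw [← lintegral_indicator_one hB, lintegral_absorptionLaw ha h1]
      · rw [absorptionLaw, if_neg ha]
    rw [h]
    refine Measurable.ite measurableSet_Iio (Measurable.mul (by fun_prop) ?_) measurable_const
    exact Measurable.lintegral_prod_right' (f := fun p : ℝ × ℝ =>
      absorptionWeight lam (T - p.1) p.2 * B.indicator 1 p.2) (by fun_prop)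

theorem absorptionLaw_univ {T lam : ℝ} (hlam : 0 < lam) (a : ℝ) :
    absorptionLaw T lam a univ = 1 := by
  by_cases ha : a < T
  · rw [← lintegral_one, lintegral_absorptionLaw ha measurable_const]
    simp only [mul_one]
    rw [lintegral_absorptionWeight hlam (sub_pos.2 ha),
      ENNReal.inv_mul_cancel (volterraMass_ne_zero hlam (sub_pos.2 ha)) (volterraMass_ne_top _ _)]
  · simp [absorptionLaw, ha]

theorem absorptionLaw_Iic_zero {T lam a : ℝ} (ha : a < T) : absorptionLaw T lam a (Iic 0) = 0 := by
  rw [← lintegral_indicator_one measurableSet_Iic, lintegral_absorptionLaw ha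
    (measurable_one.indicator measurableSet_Iic),
    setLIntegral_congr_fun (g := fun _ => 0) measurableSet_Ioi]
  · simp
  · intro r hr
    have : ¬ r ≤ 0 := not_le.2 hr
    simp [this]

theorem setLIntegral_absorptionLaw_Iic {T lam a : ℝ} (ha : a < T) {g : ℝ → ℝ≥0∞}
    (hg : Measurable g) (t : ℝ) :
    ∫⁻ r in Iic t, g r ∂absorptionLaw T lam a = (volterraMass lam (T - a))⁻¹ *
      ∫⁻ r in Ioc 0 t, absorptionWeight lam (T - a) r * g r := by
  rw [← lintegral_indicator measurableSet_Iic, lintegral_absorptionLaw ha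
    (hg.indicator measurableSet_Iic), ← Ioi_inter_Iic, inter_comm,
    ← Measure.restrict_restrict measurableSet_Iic, ← lintegral_indicator measurableSet_Iic]
  congr 1
  refine lintegral_congr fun r => ?_
  by_cases hr : r ∈ Iic t <;> simp [hr]

/-- Identifies the atom of the kernel as the distribution function of the lifetime. At t = 0 this
uses that the lifetime from a < T is positive, and at a = T that it is 0. -/
theorem volterraKernel_singleton {T lam a : ℝ} (hlam : 0 < lam) (ha : a ≤ T) (t : ℝ≥0) :
    volterraKernel T lam t a {T} = absorptionLaw T lam a (Iic t) := by
  rcases ha.eq_or_lt with rfl | ha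
  · rw [volterraKernel_of_le _ _ le_rfl, absorptionLaw, if_neg (lt_irrefl _)]
    simp
  rcases eq_or_lt_of_le (zero_le (a := t)) with rfl | ht
  · rw [NNReal.coe_zero, volterraKernel_zero, absorptionLaw_Iic_zero ha]
    simp [ha.ne]
  rw [volterraKernel_apply hlam (NNReal.coe_pos.2 ht) ha (measurableSet_singleton T), ← setLIntegral_one,
    setLIntegral_absorptionLaw_Iic ha measurable_const,
    setLIntegral_congr_fun (g := fun _ => 0) measurableSet_Ioo]
  · simp
  · intro b hb
    simp [hb.2.ne]

section PathLaw

variable {T lam : ℝ} {hlam : 0 < lam} {P : Measure CadlagPath}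

/-- Almost sure comparisons at countably many dense times extend to all times by right-continuity.
-/
theorem ae_monotone_path (hM : IsMarkovLaw pathCoord (fun s t => volterraKer T hlam (t - s)) P)
    (h0 : ∀ᵐ ω ∂P, pathCoord 0 ω ≤ T) :
    ∀ᵐ ω ∂P, Monotone ω.1 ∧ ∀ t, ω.1 t ≤ T := by
  obtain ⟨D, hDc, hD⟩ := TopologicalSpace.exists_countable_dense ℝ≥0
  have h1 : ∀ᵐ ω ∂P, ∀ d ∈ D, ∀ e ∈ D, d ≤ e → pathCoord d ω ≤ pathCoord e ω := by
    refine (ae_ball_iff hDc).2 fun d _ => (ae_ball_iff hDc).2 fun e _ => ?_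
    by_cases hde : d ≤ e
    · filter_upwards [hM.ae_le measurable_pathCoord hde fun a => volterraKer_Iio T hlam _ a]
        with ω hω _ using hω
    · exact .of_forall fun ω h => absurd h hde
  have h2 : ∀ᵐ ω ∂P, ∀ d ∈ D, pathCoord d ω ≤ T :=
    (ae_ball_iff hDc).2 fun d _ => hM.ae_le_const zero_le
      (fun a ha => volterraKer_Ioi T hlam _ ha) h0
  filter_upwards [h1, h2] with ω hω1 hω2
  have hm : Monotone ω.1 := monotone_of_monotoneOn_dense hD ω.2.1 hω1
  refine ⟨hm, fun t => ?_⟩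
  obtain ⟨d, hdD, htd, -⟩ := hD.exists_between (lt_add_one t)
  exact (hm htd.le).trans (hω2 d hdD)

/-- The probability of being at T at time n is the average over starting points of a distribution
function at n, and tends to 1. -/
theorem ae_absorptionTime_lt_top [IsProbabilityMeasure P]
    (hM : IsMarkovLaw pathCoord (fun s t => volterraKer T hlam (t - s)) P)
    (h0 : ∀ᵐ ω ∂P, pathCoord 0 ω ≤ T) : ∀ᵐ ω ∂P, absorptionTime T ω < ∞ := by
  have hprob : ∀ a, IsProbabilityMeasure (absorptionKer T lam a) := fun a =>
    ⟨absorptionLaw_univ hlam a⟩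
  have h1 : ∀ n : ℕ, P (pathCoord (n : ℝ≥0) ⁻¹' {T}) =
      ∫⁻ ω, absorptionKer T lam (pathCoord 0 ω) (Iic (n : ℝ)) ∂P := by
    intro n
    have h := hM 0 n zero_le univ MeasurableSet.univ {T} (measurableSet_singleton T)
    rw [univ_inter, Measure.restrict_univ] at h
    rw [h]
    refine lintegral_congr_ae (h0.mono fun ω hω => ?_)
    simp only [tsub_zero]
    exact volterraKernel_singleton hlam hω n
  have h2 : Tendsto (fun n : ℕ => ∫⁻ ω, absorptionKer T lam (pathCoord 0 ω) (Iic (n : ℝ)) ∂P) atTop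
      (𝓝 (∫⁻ _, 1 ∂P)) := by
    refine tendsto_lintegral_of_dominated_convergence (fun _ => 1)
      (fun n => ((absorptionKer T lam).measurable_coe measurableSet_Iic).comp
        (measurable_pathCoord 0))
      (fun n => .of_forall fun ω => prob_le_one) (by simp) (.of_forall fun ω => ?_)
    have := (tendsto_measure_Iic_atTop (absorptionKer T lam (pathCoord 0 ω))).comp
      (tendsto_natCast_atTop_atTop (R := ℝ))
    rwa [measure_univ] at this
  rw [lintegral_one, measure_univ] at h2
  have h3 : P (⋃ n : ℕ, pathCoord (n : ℝ≥0) ⁻¹' {T}) = 1 := by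
    refine le_antisymm prob_le_one (le_of_tendsto h2 (.of_forall fun n => ?_))
    rw [← h1 n]
    exact measure_mono (subset_iUnion (fun n : ℕ => pathCoord (n : ℝ≥0) ⁻¹' {T}) n)
  have h4 : MeasurableSet (⋃ n : ℕ, pathCoord (n : ℝ≥0) ⁻¹' {T}) :=
    .iUnion fun n => measurable_pathCoord _ (measurableSet_singleton T)
  filter_upwards [(mem_ae_iff_prob_eq_one h4).2 h3] with ω hω
  obtain ⟨n, hn⟩ := mem_iUnion.1 hω
  exact (iInf₂_le (n : ℝ≥0) hn).trans_lt ENNReal.coe_lt_top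

theorem aemeasurable_absorptionTime
    (hM : IsMarkovLaw pathCoord (fun s t => volterraKer T hlam (t - s)) P)
    (h0 : ∀ᵐ ω ∂P, pathCoord 0 ω ≤ T) : AEMeasurable (absorptionTime T) P := by
  obtain ⟨τ, hτ, hτe⟩ := exists_measurable_eq_absorptionTime T
  exact ⟨τ, hτ, (ae_monotone_path hM h0).mono fun ω hω => hτe ω hω.1 hω.2⟩

/-- For almost every path, `t` time units after `s` the path has been absorbed if and only if
`absorptionTime - s ≤ t`. -/
theorem ae_absorptionTime_sub_le_iff [IsProbabilityMeasure P]
    (hM : IsMarkovLaw pathCoord (fun s t => volterraKer T hlam (t - s)) P)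
    (h0 : ∀ᵐ ω ∂P, pathCoord 0 ω ≤ T) (s t : ℝ≥0) :
    ∀ᵐ ω ∂P, (absorptionTime T ω).toReal - s ≤ t ↔ pathCoord (s + t) ω = T := by
  filter_upwards [ae_monotone_path hM h0, ae_absorptionTime_lt_top hM h0] with ω hω hfin
  rw [← absorptionTime_le_iff hω.1 hω.2, sub_le_iff_le_add',
    ← ENNReal.le_ofReal_iff_toReal_le hfin.ne (by positivity), ← NNReal.coe_add,
    ENNReal.ofReal_coe_nnreal]

/-- Before absorption, the law of the remaining lifetime given the past is `absorptionLaw`. -/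
theorem map_absorptionTime_sub [IsProbabilityMeasure P]
    (hM : IsMarkovLaw pathCoord (fun s t => volterraKer T hlam (t - s)) P)
    (h0 : ∀ᵐ ω ∂P, pathCoord 0 ω ≤ T) (s : ℝ≥0) {A : Set CadlagPath}
    (hA : MeasurableSet[pastSigma pathCoord s] A) (hAT : ∀ ω ∈ A, pathCoord s ω < T) :
    (P.restrict A).map (fun ω => (absorptionTime T ω).toReal - s) =
      ((P.restrict A).map (pathCoord s)).bind (absorptionKer T lam) := by
  have hA' : MeasurableSet A := pastSigma_le measurable_pathCoord s A hA
  have hτ : AEMeasurable (fun ω => (absorptionTime T ω).toReal - s) P :=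
    (aemeasurable_absorptionTime hM h0).ennreal_toReal.sub_const _
  have hτA := hτ.mono_measure (Measure.restrict_le_self (s := A))
  have hnull : ∀ c, NullMeasurableSet
      ((fun ω => (absorptionTime T ω).toReal - s) ⁻¹' Iic c) P := fun c =>
    hτ.nullMeasurableSet_preimage measurableSet_Iic
  refine Measure.ext_of_Iic _ _ fun c => ?_
  rw [Measure.map_apply_of_aemeasurable hτA measurableSet_Iic, Measure.bind_apply measurableSet_Iic
    (absorptionKer T lam).measurable.aemeasurable,
    lintegral_map ((absorptionKer T lam).measurable_coe measurableSet_Iic) (measurable_pathCoord s),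
    Measure.restrict_apply₀ ((hnull c).mono_ac Measure.restrict_le_self.absolutelyContinuous)]
  -- For negative c both sides vanish, since paths in A are not yet absorbed at time s. For c ≥ 0
  -- the event is that of being at T at time s + c.
  rcases lt_or_ge c 0 with hc | hc
  · rw [setLIntegral_congr_fun (g := fun _ => 0) hA', lintegral_zero]
    · refine measure_eq_zero_iff_ae_notMem.2 ?_
      filter_upwards [ae_absorptionTime_sub_le_iff hM h0 s 0] with ω hω h
      refine (hAT ω h.2).ne ?_
      rw [add_zero] at hω
      refine hω.1 (le_trans (b := c) h.1 ?_)
      simpa using hc.le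
    · intro ω hω
      exact measure_mono_null (Iic_subset_Iic.2 hc.le) (absorptionLaw_Iic_zero (hAT ω hω))
  · lift c to ℝ≥0 using hc
    have h1 := hM s (s + c) (le_add_of_nonneg_right zero_le) A hA {T} (measurableSet_singleton T)
    have h2 : P ((fun ω => (absorptionTime T ω).toReal - s) ⁻¹' Iic (c : ℝ) ∩ A) =
        P (A ∩ pathCoord (s + c) ⁻¹' {T}) := by
      refine measure_congr (eventuallyEq_set.2 ?_)
      filter_upwards [ae_absorptionTime_sub_le_iff hM h0 s c] with ω hω
      exact and_comm.trans (and_congr_right fun _ => hω)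
    rw [h2, h1]
    refine setLIntegral_congr_fun hA' fun ω hω => ?_
    simp only [add_tsub_cancel_left]
    exact volterraKernel_singleton hlam (hAT ω hω).le c

end PathLaw

/-! ### The density of the path law -/

/-- Equality over sets of m says that the densities X and Y define the same measure after
restriction to m, and w only sees this restriction. No integrability is needed. -/
theorem lintegral_mul_eq_of_setLIntegral_eq {Ω : Type*} {m m₀ : MeasurableSpace Ω} (hm : m ≤ m₀)
    {P : Measure Ω} {X Y w : Ω → ℝ≥0∞} (hX : AEMeasurable X P) (hY : AEMeasurable Y P)
    (h : ∀ A, MeasurableSet[m] A → ∫⁻ ω in A, X ω ∂P = ∫⁻ ω in A, Y ω ∂P)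
    (hw : Measurable[m] w) : ∫⁻ ω, w ω * X ω ∂P = ∫⁻ ω, w ω * Y ω ∂P := by
  have htrim : (P.withDensity X).trim hm = (P.withDensity Y).trim hm := by
    refine @Measure.ext _ m _ _ fun A hA => ?_
    rw [trim_measurableSet_eq hm hA, trim_measurableSet_eq hm hA, withDensity_apply _ (hm A hA),
      withDensity_apply _ (hm A hA), h A hA]
  have hw' : Measurable w := hw.mono hm le_rfl
  have h1 : ∀ Z : Ω → ℝ≥0∞, AEMeasurable Z P →
      ∫⁻ ω, w ω * Z ω ∂P = ∫⁻ ω, w ω ∂(P.withDensity Z).trim hm := fun Z hZ => by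
    rw [lintegral_trim hm hw, lintegral_withDensity_eq_lintegral_mul₀ hZ hw'.aemeasurable]
    simp only [Pi.mul_apply, mul_comm]
  rw [h1 X hX, h1 Y hY, htrim]

theorem IsMarkovLaw.lintegral_mul_eq {ι Ω E : Type*} [MeasurableSpace E] [Preorder ι]
    [MeasurableSpace Ω] {X : ι → Ω → E} {K : ι → ι → Kernel E E} {P : Measure Ω}
    (h : IsMarkovLaw X K P) (hX : ∀ i, Measurable (X i)) {s t : ι} (hst : s ≤ t) {w : Ω → ℝ≥0∞}
    (hw : Measurable[pastSigma X s] w) {f : E → ℝ≥0∞} (hf : Measurable f) :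
    ∫⁻ ω, w ω * f (X t ω) ∂P = ∫⁻ ω, w ω * ∫⁻ y, f y ∂K s t (X s ω) ∂P :=
  lintegral_mul_eq_of_setLIntegral_eq (pastSigma_le hX s) (hf.comp (hX t)).aemeasurable
    (hf.lintegral_kernel.comp (hX s)).aemeasurable (fun _ hA => h.lintegral_eq hX hst hA hf) hw

section PathLaw

variable {T lam : ℝ} {hlam : 0 < lam} {P : Measure CadlagPath}

/-- Integration of a function of the remaining lifetime, before absorption. -/
theorem lintegral_mul_absorptionTime_sub [IsProbabilityMeasure P]
    (hM : IsMarkovLaw pathCoord (fun s t => volterraKer T hlam (t - s)) P)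
    (h0 : ∀ᵐ ω ∂P, pathCoord 0 ω ≤ T) (s : ℝ≥0) {w : CadlagPath → ℝ≥0∞}
    (hw : Measurable[pastSigma pathCoord s] w) (hwT : ∀ ω, T ≤ pathCoord s ω → w ω = 0)
    {g : ℝ → ℝ≥0∞} (hg : Measurable g) :
    ∫⁻ ω, w ω * g ((absorptionTime T ω).toReal - s) ∂P =
      ∫⁻ ω, w ω * ∫⁻ r, g r ∂absorptionLaw T lam (pathCoord s ω) ∂P := by
  have hτ : AEMeasurable (fun ω => (absorptionTime T ω).toReal - s) P :=
    (aemeasurable_absorptionTime hM h0).ennreal_toReal.sub_const _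
  have hgτ := hg.comp_aemeasurable hτ
  have hσ : Measurable fun ω => ∫⁻ r, g r ∂absorptionKer T lam (pathCoord s ω) :=
    hg.lintegral_kernel.comp (measurable_pathCoord s)
  have hSp : MeasurableSet[pastSigma pathCoord s] (pathCoord s ⁻¹' Iio T) :=
    measurable_pastSigma pathCoord le_rfl measurableSet_Iio
  have hS : MeasurableSet (pathCoord s ⁻¹' Iio T) := measurable_pathCoord s measurableSet_Iio
  -- The weight vanishes on absorbed paths, so both integrands may be cut to the unabsorbed ones,
  -- where the law of the remaining lifetime is known.
  have hind : ∀ f : CadlagPath → ℝ≥0∞, ∀ ω,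
      w ω * f ω = w ω * (pathCoord s ⁻¹' Iio T).indicator f ω := fun f ω => by
    by_cases hω : pathCoord s ω < T
    · rw [indicator_of_mem (show ω ∈ pathCoord s ⁻¹' Iio T from hω)]
    · rw [hwT ω (not_lt.1 hω), zero_mul, zero_mul]
  rw [lintegral_congr (hind fun ω => g ((absorptionTime T ω).toReal - s)),
    lintegral_congr (hind fun ω => ∫⁻ r, g r ∂absorptionLaw T lam (pathCoord s ω))]
  refine lintegral_mul_eq_of_setLIntegral_eq (pastSigma_le measurable_pathCoord s)
    (hgτ.indicator hS) (hσ.indicator hS).aemeasurable (fun A hA => ?_) hw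
  rw [setLIntegral_indicator hS, setLIntegral_indicator hS]
  have h1 := map_absorptionTime_sub hM h0 s (hSp.inter hA) fun ω hω => hω.1
  rw [← lintegral_map' hg.aemeasurable (hτ.mono_measure Measure.restrict_le_self), h1,
    Measure.lintegral_bind (absorptionKer T lam).measurable.aemeasurable hg.aemeasurable,
    lintegral_map hg.lintegral_kernel (measurable_pathCoord s)]
  rfl

end PathLaw

theorem ofReal_volterraRatio_of_lt {T lam lam' a : ℝ} (hlam : 0 < lam) (hlam' : 0 < lam')
    (ha : a < T) : ENNReal.ofReal (volterraRatio T lam lam' a) =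
      (volterraMass lam (T - a))⁻¹ * volterraMass lam' (T - a) := by
  have h1 := volterraNu_pos (mul_pos (sub_pos.2 ha) hlam)
  have h2 := volterraNu_pos (mul_pos (sub_pos.2 ha) hlam')
  rw [volterraRatio, if_pos ha, volterraMass, volterraMass, ← ENNReal.ofReal_inv_of_pos h1,
    ← ENNReal.ofReal_mul (by positivity), div_eq_inv_mul]

theorem ofReal_volterraRatio_of_le {T lam lam' a : ℝ} (ha : T ≤ a) :
    ENNReal.ofReal (volterraRatio T lam lam' a) = 1 := by
  rw [volterraRatio, if_neg ha.not_gt, ENNReal.ofReal_one]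

theorem measurable_volterraRatio (T lam lam' : ℝ) : Measurable (volterraRatio T lam lam') := by
  have := measurable_volterraNu
  unfold volterraRatio
  exact Measurable.ite measurableSet_Iio (by fun_prop) measurable_const

/-- Up to normalisation, the parameter enters only through lam^r; this is the source of the power in
the density. -/
theorem absorptionWeight_mul_rpow {lam lam' : ℝ} (hlam : 0 < lam) (hlam' : 0 < lam') {x r : ℝ}
    (hx : 0 ≤ x) (hr : 0 ≤ r) :
    absorptionWeight lam x r * ENNReal.ofReal ((lam' / lam) ^ r) = absorptionWeight lam' x r := by
  have := Real.Gamma_pos_of_pos (show 0 < r + 1 by linarith)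
  rw [absorptionWeight, absorptionWeight, ← ENNReal.ofReal_mul (by positivity),
    Real.div_rpow hlam'.le hlam.le]
  congr 1
  field_simp

theorem gammaWeight_mul_rpow {lam lam' : ℝ} (hlam : 0 < lam) (hlam' : 0 < lam') {x s : ℝ}
    (hx : 0 ≤ x) (hs : 0 < s) :
    gammaWeight lam s x * ENNReal.ofReal ((lam' / lam) ^ s) = gammaWeight lam' s x := by
  have := Real.Gamma_pos_of_pos hs
  rw [gammaWeight, gammaWeight, ← ENNReal.ofReal_mul (by positivity),
    Real.div_rpow hlam'.le hlam.le]
  congr 1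
  field_simp

/-- The reweighted lifetime weight is the one for lam', whose total mass is again a value of ν. This
explains the normalising ratio in the density. -/
theorem lintegral_rpow_absorptionLaw {T lam lam' a : ℝ} (hlam : 0 < lam) (hlam' : 0 < lam')
    (ha : a < T) : ∫⁻ r, ENNReal.ofReal ((lam' / lam) ^ r) ∂absorptionLaw T lam a =
      ENNReal.ofReal (volterraRatio T lam lam' a) := by
  rw [lintegral_absorptionLaw ha (by fun_prop), ofReal_volterraRatio_of_lt hlam hlam' ha,
    ← lintegral_absorptionWeight hlam' (sub_pos.2 ha)]
  congr 1
  exact setLIntegral_congr_fun measurableSet_Ioi fun r hr =>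
    absorptionWeight_mul_rpow hlam hlam' (sub_pos.2 ha).le (le_of_lt hr)

/-- The relation between the Volterra kernels for two values of the parameter. -/
theorem volterraKernel_change_parameter {T lam lam' a : ℝ} (hlam : 0 < lam) (hlam' : 0 < lam')
    (ha : a < T) (t : ℝ≥0) {B : Set ℝ} (hB : MeasurableSet B) :
    volterraKernel T lam' t a B * ENNReal.ofReal (volterraRatio T lam lam' a) =
      ENNReal.ofReal ((lam' / lam) ^ (t : ℝ)) *
        (∫⁻ b, B.indicator 1 b * (Iio T).indicator
          (fun b => ENNReal.ofReal (volterraRatio T lam lam' b)) b ∂volterraKernel T lam t a) +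
      B.indicator 1 T * ∫⁻ r in Iic (t : ℝ), ENNReal.ofReal ((lam' / lam) ^ r)
        ∂absorptionLaw T lam a := by
  have hmr := (measurable_volterraRatio T lam lam').ennreal_ofReal
  have h1 : Measurable (B.indicator (1 : ℝ → ℝ≥0∞)) := measurable_one.indicator hB
  have hmi : Measurable ((Iio T).indicator
      (fun b => ENNReal.ofReal (volterraRatio T lam lam' b))) := hmr.indicator measurableSet_Iio
  have hp : Measurable fun b => B.indicator (1 : ℝ → ℝ≥0∞) b * (Iio T).indicator
      (fun b => ENNReal.ofReal (volterraRatio T lam lam' b)) b := h1.mul hmi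
  rcases eq_or_lt_of_le (zero_le (a := t)) with rfl | ht
  · rw [NNReal.coe_zero, volterraKernel_zero, volterraKernel_zero,
      Measure.restrict_eq_zero.2 (absorptionLaw_Iic_zero ha), lintegral_zero_measure, mul_zero,
      add_zero, lintegral_dirac' _ hp, Measure.dirac_apply' _ hB, Real.rpow_zero,
      ENNReal.ofReal_one, one_mul, indicator_of_mem (show a ∈ Iio T from ha)]
  have ht' : (0 : ℝ) < t := ht
  have hx : 0 < T - a := sub_pos.2 ha
  -- On the right, the first term stands for paths still below T at time t, so its atom drops out.
  -- The second stands for paths absorbed at some time r ≤ t, whose factor stops growing at r.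
  rw [volterraKernel_apply hlam' ht' ha hB, lintegral_volterraKernel hlam ht' ha hp,
    setLIntegral_absorptionLaw_Iic ha (by fun_prop), ofReal_volterraRatio_of_lt hlam hlam' ha,
    indicator_of_notMem (show T ∉ Iio T from lt_irrefl T), mul_zero, mul_zero, add_zero,
    setLIntegral_congr_fun (g := absorptionWeight lam' (T - a)) measurableSet_Ioc fun r hr =>
      absorptionWeight_mul_rpow hlam hlam' hx.le hr.1.le]
  -- The ratio at b exchanges ν for lam against ν for lam', and the power of t exchanges the gamma
  -- weights.
  have h2 : ∫⁻ b in Ioo a T, volterraMass lam' (T - b) * gammaWeight lam' t (b - a) *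
        B.indicator 1 b = ENNReal.ofReal ((lam' / lam) ^ (t : ℝ)) *
      ∫⁻ b in Ioo a T, volterraMass lam (T - b) * gammaWeight lam t (b - a) *
        (B.indicator 1 b * (Iio T).indicator
          (fun b => ENNReal.ofReal (volterraRatio T lam lam' b)) b) := by
    rw [← lintegral_const_mul _ (by fun_prop)]
    refine setLIntegral_congr_fun measurableSet_Ioo fun b hb => ?_
    have hb' : 0 < T - b := sub_pos.2 hb.2
    rw [indicator_of_mem (show b ∈ Iio T from hb.2), ofReal_volterraRatio_of_lt hlam hlam' hb.2,
      ← gammaWeight_mul_rpow hlam hlam' (sub_pos.2 hb.1).le ht']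
    calc _ = (volterraMass lam (T - b) * (volterraMass lam (T - b))⁻¹) *
          (volterraMass lam' (T - b) * (gammaWeight lam t (b - a) *
            ENNReal.ofReal ((lam' / lam) ^ (t : ℝ))) * B.indicator 1 b) := by
          rw [ENNReal.mul_inv_cancel (volterraMass_ne_zero hlam hb') (volterraMass_ne_top _ _),
            one_mul]
      _ = _ := by ring
  rw [h2]
  set J := ∫⁻ b in Ioo a T, volterraMass lam (T - b) * gammaWeight lam t (b - a) *
    (B.indicator 1 b * (Iio T).indicator
      (fun b => ENNReal.ofReal (volterraRatio T lam lam' b)) b)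
  set L := ∫⁻ r in Ioc 0 (t : ℝ), absorptionWeight lam' (T - a) r
  calc _ = ((volterraMass lam' (T - a))⁻¹ * volterraMass lam' (T - a)) *
        ((volterraMass lam (T - a))⁻¹ * (ENNReal.ofReal ((lam' / lam) ^ (t : ℝ)) * J +
          L * B.indicator 1 T)) := by ring
    _ = _ := by
      rw [ENNReal.inv_mul_cancel (volterraMass_ne_zero hlam' hx) (volterraMass_ne_top _ _), one_mul]
      ring

section PathLaw

variable {T lam lam' : ℝ} {hlam : 0 < lam} {P : Measure CadlagPath} [IsProbabilityMeasure P]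

/-- The conditional expectation of `(lam' / lam) ^ absorptionTime` before absorption. -/
theorem lintegral_mul_rpow_absorptionTime (hlam' : 0 < lam')
    (hM : IsMarkovLaw pathCoord (fun s t => volterraKer T hlam (t - s)) P)
    (h0 : ∀ᵐ ω ∂P, pathCoord 0 ω ≤ T) (s : ℝ≥0) {w : CadlagPath → ℝ≥0∞}
    (hw : Measurable[pastSigma pathCoord s] w) (hwT : ∀ ω, T ≤ pathCoord s ω → w ω = 0) :
    ∫⁻ ω, w ω * ENNReal.ofReal ((lam' / lam) ^ (absorptionTime T ω).toReal) ∂P =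
      ∫⁻ ω, w ω * (ENNReal.ofReal ((lam' / lam) ^ (s : ℝ)) *
        ENNReal.ofReal (volterraRatio T lam lam' (pathCoord s ω))) ∂P := by
  have hc : 0 < lam' / lam := div_pos hlam' hlam
  -- The absorption time is s plus the remaining lifetime, so the power splits into a constant and
  -- an exponential moment of the lifetime.
  have h1 := lintegral_mul_absorptionTime_sub hM h0 s hw hwT
    (g := fun r => ENNReal.ofReal ((lam' / lam) ^ ((s : ℝ) + r))) (by fun_prop)
  simp only [add_sub_cancel] at h1
  rw [h1]
  refine lintegral_congr fun ω => ?_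
  rcases lt_or_ge (pathCoord s ω) T with h | h
  · simp_rw [Real.rpow_add hc, ENNReal.ofReal_mul (Real.rpow_nonneg hc.le _)]
    rw [← lintegral_rpow_absorptionLaw hlam hlam' h, lintegral_const_mul _ (by fun_prop)]
  · rw [hwT ω h, zero_mul, zero_mul]

/-- The Markov property for the parameter `lam'` of the law with density proportional to
`(lam' / lam) ^ absorptionTime`. -/
theorem lintegral_mul_indicator_mul_rpow_absorptionTime (hlam' : 0 < lam')
    (hM : IsMarkovLaw pathCoord (fun s t => volterraKer T hlam (t - s)) P)
    (h0 : ∀ᵐ ω ∂P, pathCoord 0 ω ≤ T) (s t : ℝ≥0) {w : CadlagPath → ℝ≥0∞}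
    (hw : Measurable[pastSigma pathCoord s] w) {B : Set ℝ} (hB : MeasurableSet B) :
    ∫⁻ ω, w ω * B.indicator 1 (pathCoord (s + t) ω) *
        ENNReal.ofReal ((lam' / lam) ^ (absorptionTime T ω).toReal) ∂P =
      ∫⁻ ω, w ω * volterraKer T hlam' t (pathCoord s ω) B *
        ENNReal.ofReal ((lam' / lam) ^ (absorptionTime T ω).toReal) ∂P := by
  have hc : 0 < lam' / lam := div_pos hlam' hlam
  have hst : s ≤ s + t := le_add_of_nonneg_right zero_le
  have hmX := measurable_pathCoord
  have h1B : Measurable (B.indicator (1 : ℝ → ℝ≥0∞)) := measurable_one.indicator hB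
  have h1T : Measurable ((Iio T).indicator (1 : ℝ → ℝ≥0∞)) :=
    measurable_one.indicator measurableSet_Iio
  have hH : Measurable fun b => ENNReal.ofReal (volterraRatio T lam lam' b) :=
    (measurable_volterraRatio T lam lam').ennreal_ofReal
  have hf : Measurable fun b => B.indicator (1 : ℝ → ℝ≥0∞) b * (Iio T).indicator
      (fun b => ENNReal.ofReal (volterraRatio T lam lam' b)) b :=
    h1B.mul (hH.indicator measurableSet_Iio)
  have hk : Measurable fun a => volterraKer T hlam' t a B := Kernel.measurable_coe _ hB
  have hS : MeasurableSet (pathCoord s ⁻¹' Iio T) := hmX s measurableSet_Iio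
  -- Paths already absorbed at s are separated, since the law of the remaining lifetime is used only
  -- before absorption.
  let w' : CadlagPath → ℝ≥0∞ := (pathCoord s ⁻¹' Iio T).indicator w
  have hw' : Measurable[pastSigma pathCoord s] w' :=
    hw.indicator (measurable_pastSigma pathCoord le_rfl measurableSet_Iio)
  have hw'm : Measurable w' := hw'.mono (pastSigma_le hmX s) le_rfl
  have hw'0 : ∀ ω, T ≤ pathCoord s ω → w' ω = 0 := fun ω hω =>
    indicator_of_notMem (show ω ∉ pathCoord s ⁻¹' Iio T from not_lt.2 hω) _
  have hw'1 : ∀ f : CadlagPath → ℝ≥0∞,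
      ∫⁻ ω in pathCoord s ⁻¹' Iio T, w ω * f ω ∂P = ∫⁻ ω, w' ω * f ω ∂P := fun f => by
    rw [← lintegral_indicator hS]
    exact lintegral_congr fun ω => by rw [indicator_mul_left]
  have hτ := aemeasurable_absorptionTime hM h0
  have hE : AEMeasurable (fun ω =>
      ENNReal.ofReal ((lam' / lam) ^ (absorptionTime T ω).toReal)) P :=
    (measurable_const.pow measurable_id).ennreal_ofReal.comp_aemeasurable hτ.ennreal_toReal
  have hbefore : ∫⁻ ω, w' ω * (B.indicator 1 (pathCoord (s + t) ω) *
        ENNReal.ofReal ((lam' / lam) ^ (absorptionTime T ω).toReal)) ∂P =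
      ∫⁻ ω, w' ω * (volterraKer T hlam' t (pathCoord s ω) B *
        ENNReal.ofReal ((lam' / lam) ^ (absorptionTime T ω).toReal)) ∂P := by
    -- the remaining lifetime exceeds `t`
    have hA : ∫⁻ ω, w' ω * (B.indicator 1 (pathCoord (s + t) ω) *
          (Iio T).indicator 1 (pathCoord (s + t) ω)) *
            ENNReal.ofReal ((lam' / lam) ^ (absorptionTime T ω).toReal) ∂P =
        ∫⁻ ω, w' ω * (ENNReal.ofReal ((lam' / lam) ^ ((s + t : ℝ≥0) : ℝ)) *
          ∫⁻ b, B.indicator 1 b * (Iio T).indicator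
            (fun b => ENNReal.ofReal (volterraRatio T lam lam' b)) b
              ∂volterraKernel T lam t (pathCoord s ω)) ∂P := by
      rw [lintegral_mul_rpow_absorptionTime hlam' hM h0 (s + t)]
      · have h2 := hM.lintegral_mul_eq hmX hst hw'
          (hf.const_mul (ENNReal.ofReal ((lam' / lam) ^ ((s + t : ℝ≥0) : ℝ))))
        simp only [add_tsub_cancel_left, lintegral_const_mul _ hf] at h2
        rw [volterraKer] at h2
        refine Eq.trans (lintegral_congr fun ω => ?_) h2
        by_cases hω : pathCoord (s + t) ω < T
        · rw [indicator_of_mem (show pathCoord (s + t) ω ∈ Iio T from hω),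
            indicator_of_mem (show pathCoord (s + t) ω ∈ Iio T from hω), Pi.one_apply]
          ring
        · rw [indicator_of_notMem (show pathCoord (s + t) ω ∉ Iio T from hω),
            indicator_of_notMem (show pathCoord (s + t) ω ∉ Iio T from hω)]
          simp
      · exact (hw'.mono (pastSigma_mono pathCoord hst) le_rfl).mul
          ((h1B.mul h1T).comp (measurable_pastSigma pathCoord le_rfl))
      · intro ω hω
        rw [indicator_of_notMem (show pathCoord (s + t) ω ∉ Iio T from not_lt.2 hω), mul_zero,
          mul_zero]
    -- the remaining lifetime is at most `t`
    have hC := lintegral_mul_absorptionTime_sub hM h0 s hw' hw'0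
      (g := fun r => B.indicator 1 T * (Iic (t : ℝ)).indicator
        (fun r => ENNReal.ofReal ((lam' / lam) ^ ((s : ℝ) + r))) r)
      (Measurable.const_mul (Measurable.indicator (by fun_prop) measurableSet_Iic) _)
    have hsplit : ∫⁻ ω, w' ω * (B.indicator 1 (pathCoord (s + t) ω) *
          ENNReal.ofReal ((lam' / lam) ^ (absorptionTime T ω).toReal)) ∂P =
        ∫⁻ ω, w' ω * (B.indicator 1 (pathCoord (s + t) ω) *
          (Iio T).indicator 1 (pathCoord (s + t) ω)) *
            ENNReal.ofReal ((lam' / lam) ^ (absorptionTime T ω).toReal) ∂P +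
        ∫⁻ ω, w' ω * (B.indicator 1 T * (Iic (t : ℝ)).indicator
          (fun r => ENNReal.ofReal ((lam' / lam) ^ ((s : ℝ) + r)))
            ((absorptionTime T ω).toReal - s)) ∂P := by
      rw [← lintegral_add_left']
      · refine lintegral_congr_ae ?_
        filter_upwards [ae_absorptionTime_sub_le_iff hM h0 s t, ae_monotone_path hM h0]
          with ω hω hmono
        have hle : pathCoord (s + t) ω ≤ T := hmono.2 _
        rcases hle.lt_or_eq with hlt | heq
        · have hnot : (absorptionTime T ω).toReal - s ∉ Iic (t : ℝ) := fun h => hlt.ne (hω.1 h)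
          rw [indicator_of_mem (show pathCoord (s + t) ω ∈ Iio T from hlt),
            indicator_of_notMem hnot, Pi.one_apply]
          ring
        · rw [heq, indicator_of_notMem (show T ∉ Iio T from lt_irrefl T),
            indicator_of_mem (show (absorptionTime T ω).toReal - s ∈ Iic (t : ℝ) from hω.2 heq),
            add_sub_cancel]
          ring
      · exact (hw'm.mul ((h1B.mul h1T).comp (hmX (s + t)))).aemeasurable.mul hE
    have hD : ∫⁻ ω, w' ω * volterraKer T hlam' t (pathCoord s ω) B *
          ENNReal.ofReal ((lam' / lam) ^ (absorptionTime T ω).toReal) ∂P = _ :=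
      lintegral_mul_rpow_absorptionTime hlam' hM h0 s
        (hw'.mul (hk.comp (measurable_pastSigma pathCoord le_rfl)))
        fun ω hω => by rw [hw'0 ω hω, zero_mul]
    have hD' : ∫⁻ ω, w' ω * (volterraKer T hlam' t (pathCoord s ω) B *
          ENNReal.ofReal ((lam' / lam) ^ (absorptionTime T ω).toReal)) ∂P = _ :=
      (lintegral_congr fun ω => (mul_assoc _ _ _).symm).trans hD
    have hm : Measurable fun ω => w' ω *
        (ENNReal.ofReal ((lam' / lam) ^ ((s + t : ℝ≥0) : ℝ)) *
          ∫⁻ b, B.indicator 1 b * (Iio T).indicator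
            (fun b => ENNReal.ofReal (volterraRatio T lam lam' b)) b
              ∂volterraKernel T lam t (pathCoord s ω)) :=
      hw'm.mul (((hf.lintegral_kernel (κ := volterraKer T hlam t)).comp (hmX s)).const_mul _)
    rw [hsplit, hA, hC, hD', ← lintegral_add_left hm]
    refine lintegral_congr fun ω => ?_
    rcases lt_or_ge (pathCoord s ω) T with h | h
    · have hcp := volterraKernel_change_parameter hlam hlam' h t hB
      rw [lintegral_const_mul _ (Measurable.indicator (by fun_prop) measurableSet_Iic),
        lintegral_indicator measurableSet_Iic]
      simp_rw [Real.rpow_add hc, NNReal.coe_add, Real.rpow_add hc,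
        ENNReal.ofReal_mul (Real.rpow_nonneg hc.le _)]
      rw [lintegral_const_mul _ (by fun_prop)]
      change _ = w' ω * volterraKernel T lam' t (pathCoord s ω) B * _
      rw [mul_assoc (w' ω), mul_left_comm (volterraKernel T lam' t (pathCoord s ω) B), hcp]
      ring
    · rw [hw'0 ω h, zero_mul, zero_mul, zero_mul, zero_mul, add_zero]
  simp only [mul_assoc]
  rw [← lintegral_add_compl _ hS, ← lintegral_add_compl (fun ω => w ω *
    (volterraKer T hlam' t (pathCoord s ω) B * _)) hS, hw'1, hw'1, hbefore]
  congr 1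
  -- After absorption the future is deterministic: the state at s + t is T and the kernel for lam'
  -- is the Dirac mass there.
  refine lintegral_congr_ae ?_
  filter_upwards [ae_restrict_of_ae (ae_monotone_path hM h0), ae_restrict_mem hS.compl] with ω hω hωS
  have h1 : T ≤ pathCoord s ω := not_lt.1 hωS
  have h2 : pathCoord (s + t) ω = T := le_antisymm (hω.2 _) (h1.trans (hω.1 hst))
  have h3 : volterraKer T hlam' t (pathCoord s ω) B = B.indicator 1 T := by
    rw [show pathCoord s ω = T from le_antisymm (hω.2 s) h1]
    change volterraKernel T lam' t T B = _
    rw [volterraKernel_of_le _ _ le_rfl, Measure.dirac_apply' _ hB]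
  rw [h2, h3]

theorem ofReal_volterraRatio_mul_swap {T lam lam' : ℝ} (hlam : 0 < lam) (hlam' : 0 < lam') (a : ℝ) :
    ENNReal.ofReal (volterraRatio T lam' lam a) * ENNReal.ofReal (volterraRatio T lam lam' a) =
      1 := by
  rcases lt_or_ge a T with h | h
  · have hx := sub_pos.2 h
    rw [ofReal_volterraRatio_of_lt hlam hlam' h, ofReal_volterraRatio_of_lt hlam' hlam h,
      mul_mul_mul_comm, mul_comm (volterraMass lam (T - a)), mul_mul_mul_comm,
      ENNReal.inv_mul_cancel (volterraMass_ne_zero hlam' hx) (volterraMass_ne_top _ _),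
      ENNReal.inv_mul_cancel (volterraMass_ne_zero hlam hx) (volterraMass_ne_top _ _), one_mul]
  · rw [ofReal_volterraRatio_of_le h, ofReal_volterraRatio_of_le h, one_mul]

/-- The density for the change of parameter does not affect the initial law. -/
theorem setLIntegral_ratio_mul_rpow_absorptionTime (hlam' : 0 < lam')
    (hM : IsMarkovLaw pathCoord (fun s t => volterraKer T hlam (t - s)) P)
    (h0 : ∀ᵐ ω ∂P, pathCoord 0 ω ≤ T) {B : Set ℝ} (hB : MeasurableSet B) :
    ∫⁻ ω in pathCoord 0 ⁻¹' B, ENNReal.ofReal (volterraRatio T lam' lam (pathCoord 0 ω)) *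
        ENNReal.ofReal ((lam' / lam) ^ (absorptionTime T ω).toReal) ∂P =
      P (pathCoord 0 ⁻¹' B) := by
  have hmX := measurable_pathCoord
  have hS : MeasurableSet (pathCoord 0 ⁻¹' Iio T) := hmX 0 measurableSet_Iio
  have hp : MeasurableSet[pastSigma pathCoord (0 : ℝ≥0)] (pathCoord 0 ⁻¹' (B ∩ Iio T)) :=
    measurable_pastSigma pathCoord le_rfl (hB.inter measurableSet_Iio)
  have hp' : MeasurableSet (pathCoord 0 ⁻¹' (B ∩ Iio T)) := hmX 0 (hB.inter measurableSet_Iio)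
  have h1 := lintegral_mul_rpow_absorptionTime hlam' hM h0 0
    (w := (pathCoord 0 ⁻¹' (B ∩ Iio T)).indicator
      fun ω => ENNReal.ofReal (volterraRatio T lam' lam (pathCoord 0 ω)))
    (((measurable_volterraRatio T lam' lam).ennreal_ofReal.comp
      (measurable_pastSigma pathCoord le_rfl)).indicator hp)
    fun ω hω => indicator_of_notMem (fun h => h.2.not_ge hω) _
  have hind : ∀ f g : CadlagPath → ℝ≥0∞,
      ∫⁻ ω, (pathCoord 0 ⁻¹' (B ∩ Iio T)).indicator f ω * g ω ∂P =
        ∫⁻ ω in pathCoord 0 ⁻¹' (B ∩ Iio T), f ω * g ω ∂P := fun f g => by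
    rw [← lintegral_indicator hp']
    exact lintegral_congr fun ω => (indicator_mul_left _ _ _).symm
  simp only [hind, NNReal.coe_zero, Real.rpow_zero, ENNReal.ofReal_one, one_mul,
    ofReal_volterraRatio_mul_swap hlam hlam', setLIntegral_one] at h1
  -- Starting points below T are covered by the conditional expectation at time 0, where the two
  -- ratios are reciprocal. From T the absorption time is 0 and the density is 1.
  rw [← lintegral_inter_add_sdiff _ _ hS, ← measure_inter_add_sdiff _ hS, ← preimage_inter, h1]
  congr 1
  rw [← setLIntegral_one]
  refine setLIntegral_congr_fun_ae ((hmX 0 hB).diff hS) ?_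
  filter_upwards [ae_monotone_path hM h0] with ω hω hωS
  have hT : T ≤ pathCoord 0 ω := not_lt.1 hωS.2
  have hτ : absorptionTime T ω = 0 := le_antisymm (by
    rw [← ENNReal.coe_zero, absorptionTime_le_iff hω.1 hω.2]
    exact le_antisymm (hω.2 0) hT) zero_le
  rw [ofReal_volterraRatio_of_le hT, hτ]
  simp

end PathLaw

/-! ### The change of measure between path laws -/

theorem IsVolterraPathLaw.ae_zero_le {T lam : ℝ} {ϑ : Measure (Icc (0 : ℝ) T)}
    {P : Measure CadlagPath} (h : IsVolterraPathLaw T lam ϑ P) : ∀ᵐ ω ∂P, pathCoord 0 ω ≤ T := by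
  refine ae_of_ae_map (measurable_pathCoord 0).aemeasurable (p := fun x => x ≤ T) ?_
  rw [h.initial, ae_map_iff measurable_subtype_coe.aemeasurable measurableSet_Iic]
  exact .of_forall fun x => x.2.2

theorem IsVolterraPathLaw.aemeasurable_density {T lam : ℝ} (hlam : 0 < lam) (lam' : ℝ)
    {ϑ : Measure (Icc (0 : ℝ) T)} {P : Measure CadlagPath} (h : IsVolterraPathLaw T lam ϑ P) :
    AEMeasurable (fun ω => ENNReal.ofReal (volterraRatio T lam' lam (pathCoord 0 ω) *
      (lam' / lam) ^ (absorptionTime T ω).toReal)) P := by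
  have hM := ((isVolterraPathLaw_iff hlam).1 h).2.2
  have hτ := (aemeasurable_absorptionTime hM h.ae_zero_le).ennreal_toReal
  exact ((((measurable_volterraRatio T lam' lam).comp (measurable_pathCoord 0)).aemeasurable).mul
    ((measurable_const.pow measurable_id).comp_aemeasurable hτ)).ennreal_ofReal

/-- The change of parameter, as a change of measure on the path space. -/
theorem IsVolterraPathLaw.withDensity {T lam lam' : ℝ} (hlam : 0 < lam) (hlam' : 0 < lam')
    {ϑ : Measure (Icc (0 : ℝ) T)} {P : Measure CadlagPath} (h : IsVolterraPathLaw T lam ϑ P) :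
    IsVolterraPathLaw T lam' ϑ (P.withDensity fun ω =>
      ENNReal.ofReal (volterraRatio T lam' lam (pathCoord 0 ω) *
        (lam' / lam) ^ (absorptionTime T ω).toReal)) := by
  have h0 := h.ae_zero_le
  have hf := h.aemeasurable_density hlam lam'
  obtain ⟨hP, hi, hM⟩ := (isVolterraPathLaw_iff hlam).1 h
  have hmX := measurable_pathCoord
  have hc : ∀ r : ℝ, 0 ≤ (lam' / lam) ^ r := fun r => Real.rpow_nonneg (div_pos hlam' hlam).le r
  have hQ : ∀ B, MeasurableSet B → P.withDensity (fun ω =>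
      ENNReal.ofReal (volterraRatio T lam' lam (pathCoord 0 ω) *
        (lam' / lam) ^ (absorptionTime T ω).toReal)) (pathCoord 0 ⁻¹' B) =
      P (pathCoord 0 ⁻¹' B) := fun B hB => by
    rw [withDensity_apply _ (hmX 0 hB),
      ← setLIntegral_ratio_mul_rpow_absorptionTime hlam' hM h0 hB]
    simp only [ENNReal.ofReal_mul' (hc _)]
  refine (isVolterraPathLaw_iff hlam').2 ⟨⟨?_⟩, ?_, ?_⟩
  · have := hQ univ MeasurableSet.univ
    rwa [preimage_univ, measure_univ (μ := P)] at this
  · rw [← hi]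
    ext B hB
    rw [Measure.map_apply (hmX 0) hB, Measure.map_apply (hmX 0) hB, hQ B hB]
  · intro s u hsu A hA B hB
    obtain ⟨t, rfl⟩ := exists_add_of_le hsu
    have hA' : MeasurableSet A := pastSigma_le hmX s A hA
    have hAB : MeasurableSet (A ∩ pathCoord (s + t) ⁻¹' B) := hA'.inter (hmX _ hB)
    have hk : Measurable fun ω => volterraKer T hlam' t (pathCoord s ω) B :=
      (Kernel.measurable_coe _ hB).comp (hmX s)
    have hkey := lintegral_mul_indicator_mul_rpow_absorptionTime hlam' hM h0 s t
      (w := A.indicator fun ω => ENNReal.ofReal (volterraRatio T lam' lam (pathCoord 0 ω)))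
      (((measurable_volterraRatio T lam' lam).ennreal_ofReal.comp
        (measurable_pastSigma pathCoord zero_le)).indicator hA) hB
    simp only [add_tsub_cancel_left]
    rw [← lintegral_indicator hA', lintegral_withDensity_eq_lintegral_mul₀ hf
      (hk.indicator hA').aemeasurable, withDensity_apply _ hAB, ← lintegral_indicator hAB]
    refine Eq.trans (lintegral_congr fun ω => ?_) (hkey.trans (lintegral_congr fun ω => ?_))
    · by_cases h1 : ω ∈ A <;> by_cases h2 : pathCoord (s + t) ω ∈ B <;>
        simp [h1, h2, ENNReal.ofReal_mul' (hc _)]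
    · by_cases h1 : ω ∈ A
      · simp only [Pi.mul_apply, indicator_of_mem h1, ENNReal.ofReal_mul' (hc _)]
        ring
      · simp [h1]

end

theorem theorem2p17 (T lam : ℝ) (hT : 0 < T) (hlam : 0 < lam)
    (ϑ : Measure (Set.Icc (0 : ℝ) T)) [IsProbabilityMeasure ϑ] :
    (∀ κ : ℝ, 0 < κ → ∃! P : Measure CadlagPath, IsVolterraPathLaw T κ ϑ P) ∧
    ∀ lam' : ℝ, 0 < lam' → ∀ P P' : Measure CadlagPath,
      IsVolterraPathLaw T lam ϑ P → IsVolterraPathLaw T lam' ϑ P' →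
        P' ≪ P ∧
        (∀ᵐ ω ∂P, absorptionTime T ω < ∞) ∧
        P'.rnDeriv P =ᵐ[P] fun ω =>
          ENNReal.ofReal
            (volterraRatio T lam' lam (pathCoord 0 ω) *
              (lam' / lam) ^ (absorptionTime T ω).toReal) := by
  refine ⟨fun κ hκ => existsUnique_isVolterraPathLaw T hκ ϑ, fun lam' hlam' P P' hP hP' => ?_⟩
  have := hP.isProbabilityMeasure
  have hM := ((isVolterraPathLaw_iff hlam).1 hP).2.2
  -- Uniqueness for `lam'` replaces P' by the measure with the claimed density, after which absolute
  -- continuity and the derivative are general facts.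
  obtain rfl := (existsUnique_isVolterraPathLaw T hlam' ϑ).unique hP' (hP.withDensity hlam hlam')
  exact ⟨withDensity_absolutelyContinuous _ _, ae_absorptionTime_lt_top hM hP.ae_zero_le,
    Measure.rnDeriv_withDensity₀ _ (hP.aemeasurable_density hlam lam')⟩
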